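/- Let $\varepsilon>0$ and let $(k_x,k_y)\in\mathbb R^2$ be a unit vector with $k_x>0$ and $k_y\neq 0$. For $\nu>0$ and a tempered distribution $g\in\mathcal S'(\mathbb R)$ consider the half-plane problem $$i(k_x\partial_x+k_y\partial_y)u+\frac{\varepsilon}{2}\left(k_x^2\partial_y^2-2k_xk_y\partial_x\partial_y+k_y^2\partial_x^2\right)u+i\nu u=0\quad\text{on }\mathbb R_+\times\mathbb R,$$ $$i\varepsilon k_y(k_x\partial_y-k_y\partial_x)u|_{x=0}+2k_x\,u|_{x=0}=2k_x\,g ,$$ whose solutions are sought among the curves $u\in C^\infty_x([0,\infty),\mathcal S'_y(\mathbb R))$ that are tempered distributions in $(x,y)$ (that is, the extension of $u$ by zero to $x<0$ belongs to $\mathcal S'(\mathbb R^2)$). For $s\in\mathbb R$ let $\|f\|_{H^s}=\|(1+|\xi|^2)^{s/2}\hat f(\xi)\|_{L^2_\xi}$ with $\hat f(\xi)=\int e^{-2\pi i y\xi}f(y)\,dy$, and let $C^b_x([0,\infty),X)$ be the space of bounded continuous functions from $[0,\infty)$ to $X$. There is a constant $C$, depending only on $\varepsilon,k_x,k_y$ (in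 particular not on $\nu$), such that for every $\nu>0$ the following hold. (1) If $g\in H^{-1/2}(\mathbb R)$, then the problem has a unique solution $u$, it belongs to $C^b_x([0,\infty),L^2_y(\mathbb R))$, and $$\|u\|_{L^\infty_x(\mathbb R_+,L^2_y(\mathbb R))}\le C\,\|g\|_{H^{-1/2}(\mathbb R)}.$$ (2) More generally, if $s\in\mathbb R$ and $g\in H^s(\mathbb R)$, then the problem has a unique solution $u$, it belongs to $C^b_x([0,\infty),H^{s+1/2}_y(\mathbb R))$, and $$\|u\|_{L^\infty_x(\mathbb R_+,H^{s+1/2}_y(\mathbb R))}\le C\,\|g\|_{H^s(\mathbb R)}.$$ -/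

import Mathlib

open Set Filter Topology MeasureTheory TemperedDistribution
open scoped NNReal ENNReal SchwartzMap ContDiff BoundedContinuousFunction

noncomputable section

/-- The slice `y ↦ Φ (x, y)` of a Schwartz function of two variables. -/
def schwartzSlice (Φ : 𝓢(ℝ × ℝ, ℂ)) (x : ℝ) : 𝓢(ℝ, ℂ) :=
  SchwartzMap.compCLMOfAntilipschitz ℂ (K := 1)
    (g := fun y : ℝ => ((x, 0) : ℝ × ℝ) + ContinuousLinearMap.inr ℝ ℝ ℝ y)
    (by fun_prop) (fun y z => by simp [Prod.edist_eq]) Φ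

theorem schwartzSlice_apply (Φ : 𝓢(ℝ × ℝ, ℂ)) (x y : ℝ) : schwartzSlice Φ x y = Φ (x, y) := by
  simp [schwartzSlice]

/-- The curve `u : [0, ∞) → 𝓢'(ℝ)` is tempered as a distribution of `(x, y)`: its extension by
zero to the plane, `Φ ↦ ∫₀^∞ ⟨u(x), Φ(x, ·)⟩ dx` (a well-defined pairing for every `Φ` which is
compactly supported in `x`), is the restriction of an element of `𝓢'(ℝ²)`. -/
def IsTemperedOnHalfPlane (u : ℝ → 𝓢'(ℝ, ℂ)) : Prop :=
  ∃ V : 𝓢'(ℝ × ℝ, ℂ), ∀ Φ : 𝓢(ℝ × ℝ, ℂ),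
    (∃ R : ℝ, ∀ x y : ℝ, R ≤ |x| → Φ (x, y) = 0) →
      V Φ = ∫ x in Ioi (0 : ℝ), u x (schwartzSlice Φ x)

/-- `u ∈ C^∞([0, ∞), 𝓢'(ℝ))` is a tempered solution of the tilted paraxial half-plane problem
with entrance datum `g`. Only the values `u x` with `0 ≤ x` matter. Smoothness of a curve in
`𝓢'(ℝ)` is smoothness of `x ↦ ⟨u(x), φ⟩` for every test function `φ`, and
`∂ₓᵏ ∂ᵧʲ u (x)` is the tempered distribution `φ ↦ (d/dx)ᵏ ⟨∂ᵧʲ u(x), φ⟩`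
(one-sided derivatives at `x = 0`). -/
structure IsHalfPlaneSolution (kx ky ε ν : ℝ) (g : 𝓢'(ℝ, ℂ)) (u : ℝ → 𝓢'(ℝ, ℂ)) : Prop where
  smooth : ∀ φ : 𝓢(ℝ, ℂ), ContDiffOn ℝ ∞ (fun x => u x φ) (Ici 0)
  tempered : IsTemperedOnHalfPlane u
  /-- `i (kx ∂ₓ + ky ∂ᵧ) u + (ε/2) (kx² ∂ᵧ² - 2 kx ky ∂ₓ∂ᵧ + ky² ∂ₓ²) u + i ν u = 0`, `x > 0`. -/
  equation : ∀ x ∈ Ioi (0 : ℝ), ∀ φ : 𝓢(ℝ, ℂ),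
    Complex.I * (kx * derivWithin (fun t => u t φ) (Ici 0) x + ky * derivCLM ℂ (u x) φ)
      + (ε / 2 : ℂ) * ((kx : ℂ) ^ 2 * derivCLM ℂ (derivCLM ℂ (u x)) φ
          - 2 * kx * ky * derivWithin (fun t => derivCLM ℂ (u t) φ) (Ici 0) x
          + (ky : ℂ) ^ 2 * iteratedDerivWithin 2 (fun t => u t φ) (Ici 0) x)
      + Complex.I * ν * u x φ = 0
  /-- `i ε ky (kx ∂ᵧ - ky ∂ₓ) u + 2 kx u = 2 kx g` at `x = 0`. -/
  boundary : ∀ φ : 𝓢(ℝ, ℂ),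
    Complex.I * ε * ky * (kx * derivCLM ℂ (u 0) φ
        - ky * derivWithin (fun t => u t φ) (Ici 0) 0)
      + 2 * kx * u 0 φ = 2 * kx * g φ

/-- `u` is the unique solution of the half-plane problem (as a curve on `[0, ∞)`). -/
def IsUniqueHalfPlaneSolution (kx ky ε ν : ℝ) (g : 𝓢'(ℝ, ℂ)) (u : ℝ → 𝓢'(ℝ, ℂ)) : Prop :=
  IsHalfPlaneSolution kx ky ε ν g u ∧
    ∀ v : ℝ → 𝓢'(ℝ, ℂ), IsHalfPlaneSolution kx ky ε ν g v → EqOn v u (Ici 0)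

/-- The norm of `H^s(ℝ)`, namely the `L²` norm of the Bessel potential of order `s`
(equivalently of `(1 + ξ²)^{s/2} 𝓕 f(ξ)`), with value `∞` when `f ∉ H^s(ℝ)`. -/
def sobolevNorm (s : ℝ) (f : 𝓢'(ℝ, ℂ)) : ℝ≥0∞ :=
  ⨅ (F : Lp ℂ 2 (volume : Measure ℝ)) (_ : besselPotential ℝ ℂ s f = (F : 𝓢'(ℝ, ℂ))), ‖F‖ₑ

/-- `‖u‖_{L^∞([0, ∞), H^σ(ℝ))}` of a continuous curve. -/
def supSobolevNorm (σ : ℝ) (u : ℝ → 𝓢'(ℝ, ℂ)) : ℝ≥0∞ :=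
  ⨆ x ∈ Ici (0 : ℝ), sobolevNorm σ (u x)

/-- `u ∈ C^b([0, ∞), H^σ(ℝ))`. -/
structure IsBoundedContinuousSobolev (σ : ℝ) (u : ℝ → 𝓢'(ℝ, ℂ)) : Prop where
  mem : ∀ x ∈ Ici (0 : ℝ), MemSobolev σ 2 (u x)
  continuous : ∀ x ∈ Ici (0 : ℝ),
    Tendsto (fun t => sobolevNorm σ (u t - u x)) (𝓝[Ici 0] x) (𝓝 0)
  bounded : supSobolevNorm σ u < ⊤

end

/-! A Fourier transform in `y` turns the equation into a quadratic in `∂ₓ` whose coefficients depend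
on `ξ`. Because `(kx, ky)` is a unit vector, its discriminant reduces to `-kx² + 4πεkyξ - 2iεky²ν`.
Damping makes the imaginary part negative, so the square root `r` can be taken with `Re r > 0`, and
then `Im r < 0`. The symbol of `∂ᵧ` is purely imaginary, so the two exponents `lamM` and `lamP` have
real parts `∓ Re r / (εky²)`: one decays, one grows.

On the decaying mode the boundary operator becomes multiplication by `kx + i r`. Its modulus is at
least `kx` and at least `|r|`, hence at least a constant times `(1 + ξ²)^(1/4)`, with no dependence
on `ν` (`norm_traceSymbol_le`). Dividing by it gains half a derivative, and `exp (x lamM)` has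
modulus at most one; the Sobolev bounds follow from Plancherel, and continuity in `x` from dominated
convergence.

Uniqueness has to be shown for curves of distributions, where the equation cannot be solved
separately for each `ξ`. The equation factors as `(∂ₓ - lamP)(∂ₓ - lamM)û = 0`. The inner factor `W`
solves a growing first order equation, so `W(0)(ψ) = W(R)(exp (-R lamP) ψ)`, a form of
`propagation`. Temperedness lets `W(R)` grow only polynomially in `R`, whereas `exp (-R lamP)`
decays faster than any power of `R` as a multiplier on Schwartz space (`family_decay`). Hence `W =
0`, the curve is `exp (x lamM) û(0)`, and the boundary condition fixes `û(0)`.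

A tempered distribution of `(x, y)` has no pointwise growth bound in `x`. The argument is therefore
run on means in `x` against translated test functions (`translatedMean`), and all bounds on
multipliers are uniform in a parameter, as recorded by `TemperateFamily`. -/

/-! ### Symbol estimates uniform in a parameter -/

/-- The derivatives up to order `n` of the functions `m i` grow at most polynomially, uniformly in
`i` up to the weight `κ i`. -/
structure TemperateFamily {ι : Type*} (n : ℕ) (κ : ι → ℝ) (m : ι → ℝ → ℂ) : Prop where
  nonneg : ∀ i, 0 ≤ κ i
  contDiff : ∀ i, ContDiff ℝ n (m i)
  bound : ∃ (k : ℕ) (C : ℝ), 0 ≤ C ∧ ∀ i, ∀ j ≤ n, ∀ x,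
    ‖iteratedDeriv j (m i) x‖ ≤ C * κ i * (1 + ‖x‖) ^ k

namespace TemperateFamily

variable {ι : Type*} {n : ℕ} {κ κ' : ι → ℝ} {m m' : ι → ℝ → ℂ}

theorem of_hasTemperateGrowth {f : ℝ → ℂ} (hf : f.HasTemperateGrowth) (n : ℕ) :
    TemperateFamily n (fun _ : ι => 1) (fun _ => f) where
  nonneg _ := zero_le_one
  contDiff _ := hf.1.of_le (mod_cast le_top)
  bound := by
    obtain ⟨k, C, hC, h⟩ := hf.norm_iteratedFDeriv_le_uniform n
    refine ⟨k, C, hC, fun _ j hj x => ?_⟩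
    rw [← norm_iteratedFDeriv_eq_norm_iteratedDeriv, mul_one]
    exact h j hj x

theorem const (n : ℕ) (c : ι → ℂ) : TemperateFamily n (fun i => ‖c i‖) (fun i _ => c i) where
  nonneg _ := norm_nonneg _
  contDiff _ := contDiff_const
  bound := by
    refine ⟨0, 1, zero_le_one, fun i j _ x => ?_⟩
    rw [iteratedDeriv_const]
    split_ifs <;> simp

theorem hasTemperateGrowth (h : ∀ n, TemperateFamily n κ m) (i : ι) :
    (m i).HasTemperateGrowth := by
  refine ⟨contDiff_infty.2 fun n => (h n).contDiff i, fun n => ?_⟩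
  obtain ⟨k, C, -, hC⟩ := (h n).bound
  refine ⟨k, C * κ i, fun x => ?_⟩
  rw [norm_iteratedFDeriv_eq_norm_iteratedDeriv]
  exact hC i n le_rfl x

theorem mono_weight (h : TemperateFamily n κ m) (hκ : ∀ i, κ i ≤ κ' i) :
    TemperateFamily n κ' m where
  nonneg i := (h.nonneg i).trans (hκ i)
  contDiff := h.contDiff
  bound := by
    obtain ⟨k, C, hC, hb⟩ := h.bound
    refine ⟨k, C, hC, fun i j hj x => (hb i j hj x).trans ?_⟩
    gcongr
    exact hκ i

theorem mul (h : TemperateFamily n κ m) (h' : TemperateFamily n κ' m') :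
    TemperateFamily n (fun i => κ i * κ' i) (fun i x => m i x * m' i x) where
  nonneg i := mul_nonneg (h.nonneg i) (h'.nonneg i)
  contDiff i := (h.contDiff i).mul (h'.contDiff i)
  bound := by
    obtain ⟨k, C, hC, hb⟩ := h.bound
    obtain ⟨k', C', hC', hb'⟩ := h'.bound
    refine ⟨k + k', 2 ^ n * (C * C'), by positivity, fun i j hj x => ?_⟩
    have hκ := h.nonneg i
    have hκ' := h'.nonneg i
    rw [← norm_iteratedFDeriv_eq_norm_iteratedDeriv]
    refine (norm_iteratedFDeriv_mul_le (h.contDiff i) (h'.contDiff i) x (mod_cast hj)).trans ?_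
    have : ∀ l ∈ Finset.range (j + 1), (j.choose l : ℝ) * ‖iteratedFDeriv ℝ l (m i) x‖ *
        ‖iteratedFDeriv ℝ (j - l) (m' i) x‖ ≤
        (j.choose l : ℝ) * ((C * κ i * (1 + ‖x‖) ^ k) * (C' * κ' i * (1 + ‖x‖) ^ k')) := by
      intro l hl
      rw [Finset.mem_range_succ_iff] at hl
      rw [mul_assoc]
      simp only [norm_iteratedFDeriv_eq_norm_iteratedDeriv]
      gcongr
      · exact hb i l (hl.trans hj) x
      · exact hb' i (j - l) (by omega) x
    refine (Finset.sum_le_sum this).trans ?_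
    rw [← Finset.sum_mul]
    have h2 : (∑ l ∈ Finset.range (j + 1), (j.choose l : ℝ)) = 2 ^ j := by
      exact_mod_cast Nat.sum_range_choose j
    rw [h2]
    calc (2 : ℝ) ^ j * ((C * κ i * (1 + ‖x‖) ^ k) * (C' * κ' i * (1 + ‖x‖) ^ k'))
        ≤ 2 ^ n * ((C * κ i * (1 + ‖x‖) ^ k) * (C' * κ' i * (1 + ‖x‖) ^ k')) := by
          gcongr
          norm_num
      _ = _ := by ring

/-- The inductive step for bounds of every order: when the derivative of a symbol is expressed
through symbols already controlled, only a pointwise bound remains to be checked. -/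
theorem of_deriv (hnn : ∀ i, 0 ≤ κ i) (hd : ∀ i, Differentiable ℝ (m i))
    (h : TemperateFamily n κ fun i => deriv (m i))
    (h0 : ∃ (k : ℕ) (C : ℝ), 0 ≤ C ∧ ∀ i x, ‖m i x‖ ≤ C * κ i * (1 + ‖x‖) ^ k) :
    TemperateFamily (n + 1) κ m where
  nonneg := hnn
  contDiff i := by
    push_cast
    exact contDiff_succ_iff_deriv.2 ⟨hd i, by simp, h.contDiff i⟩
  bound := by
    obtain ⟨k, C, hC, hb⟩ := h0
    obtain ⟨k', C', hC', hb'⟩ := h.bound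
    refine ⟨k + k', C + C', by positivity, fun i j hj x => ?_⟩
    have hκ := hnn i
    rcases j with _ | j
    · rw [iteratedDeriv_zero]
      refine (hb i x).trans ?_
      gcongr
      · linarith
      · simp
      · omega
    · rw [iteratedDeriv_succ']
      refine (hb' i j (by omega) x).trans ?_
      gcongr
      · linarith
      · simp
      · omega

theorem zero_order (hnn : ∀ i, 0 ≤ κ i) (hd : ∀ i, Continuous (m i))
    (h0 : ∃ (k : ℕ) (C : ℝ), 0 ≤ C ∧ ∀ i x, ‖m i x‖ ≤ C * κ i * (1 + ‖x‖) ^ k) :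
    TemperateFamily 0 κ m where
  nonneg := hnn
  contDiff i := contDiff_zero.2 (hd i)
  bound := by
    obtain ⟨k, C, hC, hb⟩ := h0
    refine ⟨k, C, hC, fun i j hj x => ?_⟩
    obtain rfl : j = 0 := by omega
    simpa using hb i x

end TemperateFamily

/-! ### An increasing sequence of norms on Schwartz space -/

namespace SchwartzMap

variable {E : Type*} [NormedAddCommGroup E] [NormedSpace ℝ E]

/-- The increasing sequence of norms defining the topology of the Schwartz space. -/
noncomputable def norms (E : Type*) [NormedAddCommGroup E] [NormedSpace ℝ E] (N : ℕ) :
    Seminorm ℂ 𝓢(E, ℂ) :=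
  (Finset.Iic (N, N)).sup (schwartzSeminormFamily ℂ E ℂ)

theorem norms_mono {N N' : ℕ} (h : N ≤ N') (φ : 𝓢(E, ℂ)) : norms E N φ ≤ norms E N' φ := by
  refine Seminorm.le_def.1 (Finset.sup_mono ?_) φ
  exact Finset.Iic_subset_Iic.2 ⟨h, h⟩

theorem seminorm_le_norms {k n N : ℕ} (hk : k ≤ N) (hn : n ≤ N) (φ : 𝓢(E, ℂ)) :
    SchwartzMap.seminorm ℂ k n φ ≤ norms E N φ := by
  have : (schwartzSeminormFamily ℂ E ℂ) (k, n) ≤ norms E N :=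
    Finset.le_sup (f := schwartzSeminormFamily ℂ E ℂ) (Finset.mem_Iic.2 ⟨hk, hn⟩)
  exact Seminorm.le_def.1 this φ

theorem norms_le_iff {N : ℕ} {φ : 𝓢(E, ℂ)} {M : ℝ} (hM : 0 ≤ M) :
    norms E N φ ≤ M ↔ ∀ k ≤ N, ∀ n ≤ N, SchwartzMap.seminorm ℂ k n φ ≤ M := by
  refine ⟨fun h k hk n hn => (seminorm_le_norms hk hn φ).trans h, fun h => ?_⟩
  refine Seminorm.finset_sup_apply_le hM fun i hi => ?_
  rw [Finset.mem_Iic] at hi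
  exact h i.1 hi.1 i.2 hi.2

theorem one_add_pow_mul_le_norms {k n N : ℕ} (hk : k ≤ N) (hn : n ≤ N) (φ : 𝓢(E, ℂ)) (x : E) :
    (1 + ‖x‖) ^ k * ‖iteratedFDeriv ℝ n φ x‖ ≤ 2 ^ N * norms E N φ :=
  one_add_le_sup_seminorm_apply (𝕜 := ℂ) (m := (N, N)) hk hn φ x

theorem exists_norms_bound (q : Seminorm ℂ 𝓢(E, ℂ)) (hq : Continuous q) :
    ∃ (N : ℕ) (C : ℝ), 0 ≤ C ∧ ∀ φ, q φ ≤ C * norms E N φ := by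
  obtain ⟨s, C, -, h⟩ := Seminorm.bound_of_continuous (schwartz_withSeminorms ℂ E ℂ) q hq
  refine ⟨s.sup fun p => max p.1 p.2, C, C.2, fun φ => (Seminorm.le_def.1 h φ).trans ?_⟩
  rw [smul_apply, NNReal.smul_def, smul_eq_mul]
  gcongr
  refine Seminorm.le_def.1 (Finset.sup_mono fun p hp => ?_) φ
  have := Finset.le_sup (f := fun p : ℕ × ℕ => max p.1 p.2) hp
  exact Finset.mem_Iic.2 ⟨(le_max_left _ _).trans this, (le_max_right _ _).trans this⟩

theorem exists_norm_le_norms (T : 𝓢(E, ℂ) →L[ℂ] ℂ) :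
    ∃ (N : ℕ) (C : ℝ), 0 ≤ C ∧ ∀ φ, ‖T φ‖ ≤ C * norms E N φ :=
  exists_norms_bound ((normSeminorm ℂ ℂ).comp T.toLinearMap) (continuous_norm.comp T.continuous)

theorem continuous_norms (N : ℕ) : Continuous (norms E N) :=
  Finset.sup_induction (p := fun q : Seminorm ℂ 𝓢(E, ℂ) => Continuous q) continuous_const
    (fun _ hp _ hq => hp.sup hq) fun i _ => (schwartz_withSeminorms ℂ E ℂ).continuous_seminorm i

theorem exists_norms_le_norms {F : Type*} [NormedAddCommGroup F] [NormedSpace ℝ F]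
    (T : 𝓢(E, ℂ) →L[ℂ] 𝓢(F, ℂ)) (M : ℕ) :
    ∃ (N : ℕ) (C : ℝ), 0 ≤ C ∧ ∀ φ, norms F M (T φ) ≤ C * norms E N φ :=
  exists_norms_bound ((norms F M).comp T.toLinearMap) ((continuous_norms M).comp T.continuous)

end SchwartzMap

/-- Leibniz's rule, with the growth exponent `l` of the symbols absorbed by `l` extra powers of the
weight on `φ`. The constant depends on `i` only through `κ i`, which is how decay in a parameter
reaches the operator bounds. -/
theorem TemperateFamily.exists_norms_smulLeftCLM_le {ι : Type*} {κ : ι → ℝ} {m : ι → ℝ → ℂ}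
    (h : ∀ n, TemperateFamily n κ m) (M : ℕ) :
    ∃ (N : ℕ) (C : ℝ), 0 ≤ C ∧ ∀ i (φ : 𝓢(ℝ, ℂ)),
      SchwartzMap.norms ℝ M (SchwartzMap.smulLeftCLM ℂ (m i) φ) ≤
        C * κ i * SchwartzMap.norms ℝ N φ := by
  obtain ⟨l, C, hC, hb⟩ := (h M).bound
  refine ⟨M + l, 2 ^ M * (C * 2 ^ (M + l)), by positivity, fun i φ => ?_⟩
  have hg := hasTemperateGrowth h i
  have hκ := (h M).nonneg i
  have hN := apply_nonneg (SchwartzMap.norms ℝ (M + l)) φ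
  rw [SchwartzMap.norms_le_iff (by positivity)]
  intro k hk n hn
  refine SchwartzMap.seminorm_le_bound ℂ k n _ (by positivity) fun x => ?_
  rw [SchwartzMap.smulLeftCLM_apply hg]
  simp only [smul_eq_mul]
  have key : ∀ j ∈ Finset.range (n + 1), (n.choose j : ℝ) * ‖iteratedFDeriv ℝ j (m i) x‖ *
      ‖iteratedFDeriv ℝ (n - j) φ x‖ ≤ (n.choose j : ℝ) * ((C * κ i) * ((1 + ‖x‖) ^ l *
        ‖iteratedFDeriv ℝ (n - j) φ x‖)) := by
    intro j hj
    rw [Finset.mem_range_succ_iff] at hj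
    rw [mul_assoc, ← mul_assoc (C * κ i), norm_iteratedFDeriv_eq_norm_iteratedDeriv (f := m i)]
    gcongr
    exact hb i j (hj.trans hn) x
  calc ‖x‖ ^ k * ‖iteratedFDeriv ℝ n (fun x => m i x * φ x) x‖
      ≤ (1 + ‖x‖) ^ k * ∑ j ∈ Finset.range (n + 1), (n.choose j : ℝ) * ((C * κ i) *
        ((1 + ‖x‖) ^ l * ‖iteratedFDeriv ℝ (n - j) φ x‖)) := by
        gcongr
        · simp
        · exact (norm_iteratedFDeriv_mul_le hg.1 (φ.smooth ⊤) x (mod_cast le_top)).trans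
            (Finset.sum_le_sum key)
    _ ≤ ∑ j ∈ Finset.range (n + 1), (n.choose j : ℝ) * ((C * κ i) *
        (2 ^ (M + l) * SchwartzMap.norms ℝ (M + l) φ)) := by
        rw [Finset.mul_sum]
        refine Finset.sum_le_sum fun j hj => ?_
        have := SchwartzMap.one_add_pow_mul_le_norms (k := k + l) (n := n - j) (N := M + l)
          (by omega) (by omega) φ x
        rw [pow_add] at this
        calc _ = (n.choose j : ℝ) * ((C * κ i) *
              ((1 + ‖x‖) ^ k * (1 + ‖x‖) ^ l * ‖iteratedFDeriv ℝ (n - j) φ x‖)) := by ring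
          _ ≤ _ := by gcongr
    _ ≤ _ := by
        rw [← Finset.sum_mul]
        have h2 : (∑ l ∈ Finset.range (n + 1), (n.choose l : ℝ)) = 2 ^ n := by
          exact_mod_cast Nat.sum_range_choose n
        rw [h2]
        calc (2 : ℝ) ^ n * ((C * κ i) * (2 ^ (M + l) * SchwartzMap.norms ℝ (M + l) φ))
            ≤ 2 ^ M * ((C * κ i) * (2 ^ (M + l) * SchwartzMap.norms ℝ (M + l) φ)) := by
              gcongr
              norm_num
          _ = _ := by ring

/-! ### Exponential multipliers -/

theorem Complex.norm_exp_sub_one_le_of_re_nonpos {z : ℂ} (hz : z.re ≤ 0) :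
    ‖Complex.exp z - 1‖ ≤ ‖z‖ := by
  have := Convex.norm_image_sub_le_of_norm_hasDerivWithin_le (𝕜 := ℂ) (f := Complex.exp)
    (f' := Complex.exp) (s := {w : ℂ | w.re ≤ 0}) (C := 1) (x := 0) (y := z)
    (fun w _ => (Complex.hasDerivAt_exp w).hasDerivWithinAt)
    (fun w hw => by
      rw [Complex.norm_exp]
      exact Real.exp_le_one_iff.2 hw)
    (convex_halfSpace_re_le 0) (by simp) hz
  simpa using this

theorem Complex.norm_exp_sub_one_sub_id_le_of_re_nonpos {z : ℂ} (hz : z.re ≤ 0) :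
    ‖Complex.exp z - 1 - z‖ ≤ ‖z‖ ^ 2 := by
  have := Convex.norm_image_sub_le_of_norm_hasDerivWithin_le (𝕜 := ℂ)
    (f := fun w => Complex.exp w - 1 - w)
    (f' := fun w => Complex.exp w - 1) (s := {w : ℂ | w.re ≤ 0} ∩ Metric.closedBall 0 ‖z‖)
    (C := ‖z‖) (x := 0) (y := z)
    (fun w _ => (((Complex.hasDerivAt_exp w).sub_const 1).sub (hasDerivAt_id w)).hasDerivWithinAt)
    (fun w hw => (Complex.norm_exp_sub_one_le_of_re_nonpos hw.1).trans (by simpa using hw.2))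
    ((convex_halfSpace_re_le 0).inter (convex_closedBall _ _)) (by simp) (by simpa using hz)
  simpa [sq] using this

/-- A smooth exponent of temperate growth whose real part is negative, and not too small. -/
structure IsDecayExponent (a : ℝ → ℂ) : Prop where
  temperate : a.HasTemperateGrowth
  neg : ∀ ξ, (a ξ).re < 0
  lower : ∃ (k : ℕ) (C : ℝ), 0 ≤ C ∧ ∀ ξ, 1 ≤ C * (1 + ‖ξ‖) ^ k * (-(a ξ).re)

/-- The multiplier `ξ ↦ exp (s a(ξ))`. -/
noncomputable def expMul (a : ℝ → ℂ) (s : ℝ≥0) (ξ : ℝ) : ℂ := Complex.exp ((s : ℝ) * a ξ)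

theorem norm_expMul (a : ℝ → ℂ) (s : ℝ≥0) (ξ : ℝ) :
    ‖expMul a s ξ‖ = Real.exp (s * (a ξ).re) := by
  rw [expMul, Complex.norm_exp, Complex.re_ofReal_mul]

theorem expMul_add (a : ℝ → ℂ) (s t : ℝ≥0) (ξ : ℝ) :
    expMul a (s + t) ξ = expMul a s ξ * expMul a t ξ := by
  rw [expMul, expMul, expMul, ← Complex.exp_add]
  push_cast
  ring_nf

theorem expMul_zero (a : ℝ → ℂ) (ξ : ℝ) : expMul a 0 ξ = 1 := by simp [expMul]

namespace IsDecayExponent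

variable {a : ℝ → ℂ} (ha : IsDecayExponent a)
include ha

theorem differentiable : Differentiable ℝ a := ha.temperate.1.differentiable (by simp)

theorem temperate_deriv : (deriv a).HasTemperateGrowth := by
  refine ⟨(contDiff_infty_iff_deriv.1 ha.temperate.1).2, fun n => ?_⟩
  obtain ⟨k, C, h⟩ := ha.temperate.2 (n + 1)
  refine ⟨k, C, fun x => ?_⟩
  rw [norm_iteratedFDeriv_eq_norm_iteratedDeriv, ← iteratedDeriv_succ',
    ← norm_iteratedFDeriv_eq_norm_iteratedDeriv]
  exact h x

theorem hasDerivAt_expMul (s : ℝ≥0) (ξ : ℝ) :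
    HasDerivAt (expMul a s) ((s : ℝ) * deriv a ξ * expMul a s ξ) ξ := by
  have := ((ha.differentiable ξ).hasDerivAt.const_mul ((s : ℝ) : ℂ)).cexp
  rw [mul_comm] at this
  exact this

/-- The real part of `a` may tend to zero as `ξ` grows, so there is no uniform exponential decay.
The lower bound on `-Re a` still allows any power of `s` to be gained at the price of powers of `1 +
|ξ|`. -/
theorem exists_pointwise_decay (k : ℕ) : ∃ (l : ℕ) (C : ℝ), 0 ≤ C ∧ ∀ (s : ℝ≥0) ξ,
    ‖expMul a s ξ‖ ≤ C * ((1 + (s : ℝ)) ^ k)⁻¹ * (1 + ‖ξ‖) ^ l := by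
  obtain ⟨l, C, hC, h⟩ := ha.lower
  -- The factorial comes from `(1 + sb)^k / k! ≤ exp (1 + sb)`, and `exp 1` from the added one in
  -- that exponent. Replacing `C` by `max C 1` makes `D ≥ 1`, so that `(1 + s) / D ≤ 1 + sb`.
  refine ⟨l * k, k.factorial * Real.exp 1 * (max C 1) ^ k, by positivity, fun s ξ => ?_⟩
  rw [norm_expMul]
  set b := -(a ξ).re with hb
  have hb0 : 0 < b := by linarith [ha.neg ξ]
  have hab : (a ξ).re = -b := by linarith
  have hs : (0 : ℝ) ≤ s := s.coe_nonneg
  set D := max C 1 * (1 + ‖ξ‖) ^ l with hD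
  have hD1 : 1 ≤ D := by
    have : 1 ≤ (1 + ‖ξ‖) ^ l := one_le_pow₀ (by simp)
    have h1 : (1 : ℝ) ≤ max C 1 := le_max_right _ _
    nlinarith
  have hDb : 1 ≤ D * b := by
    refine (h ξ).trans ?_
    rw [hD]
    gcongr
    exact le_max_left _ _
  have h1 : (1 + (s : ℝ)) / D ≤ 1 + s * b := by
    rw [div_le_iff₀ (by linarith)]
    nlinarith
  have h2 := Real.pow_div_factorial_le_exp (1 + s * b) (by positivity) k
  have h3 : ((1 + (s : ℝ)) / D) ^ k ≤ k.factorial * (Real.exp 1 * Real.exp (s * b)) := by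
    rw [← Real.exp_add]
    rw [div_le_iff₀ (by positivity)] at h2
    calc _ ≤ (1 + s * b) ^ k := by gcongr
      _ ≤ _ := by linarith
  rw [hab, mul_neg, Real.exp_neg]
  rw [div_pow, div_le_iff₀ (by positivity)] at h3
  have hE := Real.exp_pos (s * b)
  have h4 : D ^ k = (max C 1) ^ k * (1 + ‖ξ‖) ^ (l * k) := by
    rw [hD, mul_pow, ← pow_mul]
  rw [h4] at h3
  rw [inv_le_iff_one_le_mul₀ hE]
  rw [show (k.factorial * Real.exp 1 * max C 1 ^ k * ((1 + (s : ℝ)) ^ k)⁻¹ * (1 + ‖ξ‖) ^ (l * k)) *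
    Real.exp (s * b) = (k.factorial * (Real.exp 1 * Real.exp (s * b)) *
      (max C 1 ^ k * (1 + ‖ξ‖) ^ (l * k))) / (1 + (s : ℝ)) ^ k by ring]
  rw [le_div_iff₀ (by positivity), one_mul]
  exact h3

theorem family_decay (n k : ℕ) :
    TemperateFamily n (fun s : ℝ≥0 => ((1 + (s : ℝ)) ^ k)⁻¹) (expMul a) := by
  have hd := fun s ξ => ha.hasDerivAt_expMul s ξ
  induction n generalizing k with
  | zero =>
    exact .zero_order (fun s => by positivity)
      (fun s => (show Differentiable ℝ _ from fun ξ => (hd s ξ).differentiableAt).continuous)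
      (ha.exists_pointwise_decay k)
  | succ n ih =>
    refine .of_deriv (fun s => by positivity) (fun s ξ => (hd s ξ).differentiableAt) ?_
      (ha.exists_pointwise_decay k)
    -- Each derivative in `ξ` produces a factor `s`, paid for by using the induction hypothesis with
    -- decay order `k + 1`; this is why `k` is generalized.
    have := (((TemperateFamily.const n fun s : ℝ≥0 => ((s : ℝ) : ℂ)).mul
      (.of_hasTemperateGrowth ha.temperate_deriv n)).mul (ih (k + 1)))
    simp only [← fun s ξ => (hd s ξ).deriv] at this
    refine this.mono_weight fun s => ?_
    rw [Complex.norm_real, Real.norm_of_nonneg s.coe_nonneg, mul_one, pow_succ, mul_inv]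
    have hs : (s : ℝ) * (1 + (s : ℝ))⁻¹ ≤ 1 := by
      have := s.coe_nonneg
      rw [mul_inv_le_iff₀ (by positivity)]
      linarith
    calc (s : ℝ) * (((1 + (s : ℝ)) ^ k)⁻¹ * (1 + (s : ℝ))⁻¹)
        = ((1 + (s : ℝ)) ^ k)⁻¹ * ((s : ℝ) * (1 + (s : ℝ))⁻¹) := by ring
      _ ≤ ((1 + (s : ℝ)) ^ k)⁻¹ * 1 := by gcongr
      _ = _ := mul_one _

theorem family (n : ℕ) : TemperateFamily n (fun _ : ℝ≥0 => 1) (expMul a) :=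
  (ha.family_decay n 0).mono_weight (by simp)

theorem temperate_expMul (s : ℝ≥0) : (expMul a s).HasTemperateGrowth :=
  TemperateFamily.hasTemperateGrowth ha.family s

/-- No induction is needed: the first derivative `s a' exp (sa)` already carries the weight `s`, and
`family` controls the rest. The second order remainder is reduced to this lemma in the same way. -/
theorem family_sub_one (n : ℕ) :
    TemperateFamily n (fun s : ℝ≥0 => (s : ℝ)) (fun s ξ => expMul a s ξ - 1) := by
  have hd := fun s ξ => (ha.hasDerivAt_expMul s ξ).sub_const 1
  obtain ⟨k, C, hC, hb⟩ := (TemperateFamily.of_hasTemperateGrowth (ι := Unit) ha.temperate 0).bound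
  have h0 : ∃ (k : ℕ) (C : ℝ), 0 ≤ C ∧ ∀ (s : ℝ≥0) ξ,
      ‖expMul a s ξ - 1‖ ≤ C * s * (1 + ‖ξ‖) ^ k := by
    refine ⟨k, C, hC, fun s ξ => ?_⟩
    have hs := s.coe_nonneg
    refine (Complex.norm_exp_sub_one_le_of_re_nonpos ?_).trans ?_
    · rw [Complex.re_ofReal_mul]
      exact mul_nonpos_of_nonneg_of_nonpos hs (ha.neg ξ).le
    · have := hb () 0 le_rfl ξ
      simp only [iteratedDeriv_zero, mul_one] at this
      rw [norm_mul, Complex.norm_real, Real.norm_of_nonneg hs, mul_right_comm, mul_comm]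
      gcongr
  cases n with
  | zero =>
    exact .zero_order (fun s => s.2) (fun s =>
      (show Differentiable ℝ _ from fun ξ => (hd s ξ).differentiableAt).continuous) h0
  | succ n =>
    refine .of_deriv (fun s => s.2) (fun s ξ => (hd s ξ).differentiableAt) ?_ h0
    have := (((TemperateFamily.const n fun s : ℝ≥0 => ((s : ℝ) : ℂ)).mul
      (.of_hasTemperateGrowth ha.temperate_deriv n)).mul (ha.family n))
    simp only [← fun s ξ => (hd s ξ).deriv] at this
    refine this.mono_weight fun s => ?_
    rw [Complex.norm_real, Real.norm_of_nonneg s.coe_nonneg, mul_one, mul_one]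

theorem family_sub_one_sub (n : ℕ) : TemperateFamily n (fun s : ℝ≥0 => (s : ℝ) ^ 2)
    (fun s ξ => expMul a s ξ - 1 - (s : ℝ) * a ξ) := by
  have hd : ∀ (s : ℝ≥0) ξ, HasDerivAt (fun ξ => expMul a s ξ - 1 - (s : ℝ) * a ξ)
      ((s : ℝ) * deriv a ξ * expMul a s ξ - (s : ℝ) * deriv a ξ) ξ := fun s ξ =>
    ((ha.hasDerivAt_expMul s ξ).sub_const 1).sub ((ha.differentiable ξ).hasDerivAt.const_mul ((s : ℝ) : ℂ))
  obtain ⟨k, C, hC, hb⟩ := (TemperateFamily.of_hasTemperateGrowth (ι := Unit) ha.temperate 0).bound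
  have h0 : ∃ (k : ℕ) (C : ℝ), 0 ≤ C ∧ ∀ (s : ℝ≥0) ξ,
      ‖expMul a s ξ - 1 - (s : ℝ) * a ξ‖ ≤ C * (s : ℝ) ^ 2 * (1 + ‖ξ‖) ^ k := by
    refine ⟨k * 2, C ^ 2, by positivity, fun s ξ => ?_⟩
    have hs := s.coe_nonneg
    refine (Complex.norm_exp_sub_one_sub_id_le_of_re_nonpos ?_).trans ?_
    · rw [Complex.re_ofReal_mul]
      exact mul_nonpos_of_nonneg_of_nonpos hs (ha.neg ξ).le
    · have := hb () 0 le_rfl ξ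
      simp only [iteratedDeriv_zero, mul_one] at this
      rw [norm_mul, Complex.norm_real, Real.norm_of_nonneg hs, mul_pow, pow_mul]
      calc (s : ℝ) ^ 2 * ‖a ξ‖ ^ 2 ≤ (s : ℝ) ^ 2 * (C * (1 + ‖ξ‖) ^ k) ^ 2 := by gcongr
        _ = _ := by ring
  cases n with
  | zero =>
    exact .zero_order (fun s => by positivity) (fun s =>
      (show Differentiable ℝ _ from fun ξ => (hd s ξ).differentiableAt).continuous) h0
  | succ n =>
    refine .of_deriv (fun s => by positivity) (fun s ξ => (hd s ξ).differentiableAt) ?_ h0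
    have h1 := (((TemperateFamily.const n fun s : ℝ≥0 => ((s : ℝ) : ℂ)).mul
      (.of_hasTemperateGrowth ha.temperate_deriv n)).mul (ha.family_sub_one n))
    have h2 : (fun (s : ℝ≥0) (ξ : ℝ) => (s : ℝ) * deriv a ξ * (expMul a s ξ - 1)) =
        fun (s : ℝ≥0) => deriv (fun ξ => expMul a s ξ - 1 - (s : ℝ) * a ξ) := by
      funext s ξ
      rw [(hd s ξ).deriv]
      ring
    rw [h2] at h1
    refine h1.mono_weight fun s => ?_
    rw [Complex.norm_real, Real.norm_of_nonneg s.coe_nonneg, mul_one, sq]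

end IsDecayExponent

/-- Bootstrap for a bounded function whose derivative is a polynomial in itself with temperate
coefficients: control of `n` derivatives of `g` gives control of `n` derivatives of `g'`. It applies
to `1 / r`, whose derivative is a multiple of its cube, and to the inverse boundary symbol. -/
theorem Function.HasTemperateGrowth.of_deriv_closed {g : ℝ → ℂ} (hd : Differentiable ℝ g) {C : ℝ}
    (hC : ∀ x, ‖g x‖ ≤ C)
    (h : ∀ n, TemperateFamily n (fun _ : Unit => 1) (fun _ => g) →
      TemperateFamily n (fun _ : Unit => 1) (fun _ => deriv g)) :
    g.HasTemperateGrowth := by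
  have h0 : ∃ (k : ℕ) (C : ℝ), 0 ≤ C ∧ ∀ (_ : Unit) x, ‖g x‖ ≤ C * 1 * (1 + ‖x‖) ^ k :=
    ⟨0, C, (norm_nonneg _).trans (hC 0), fun _ x => by simpa using hC x⟩
  have key : ∀ n, TemperateFamily n (fun _ : Unit => 1) (fun _ => g) := by
    intro n
    induction n with
    | zero => exact .zero_order (fun _ => zero_le_one) (fun _ => hd.continuous) h0
    | succ n ih => exact .of_deriv (fun _ => zero_le_one) (fun _ => hd) (h n ih) h0
  exact TemperateFamily.hasTemperateGrowth key ()

/-! ### Characteristic roots and the boundary symbol -/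

namespace TiltedParaxial

/-- The parameters of the half-plane problem. -/
structure IsAdmissible (kx ky ε ν : ℝ) : Prop where
  unit : kx ^ 2 + ky ^ 2 = 1
  kx_pos : 0 < kx
  ky_ne : ky ≠ 0
  eps_pos : 0 < ε
  nu_pos : 0 < ν

/-- The symbol of `∂ᵧ`. -/
noncomputable def derivSymbol (ξ : ℝ) : ℂ := 2 * Real.pi * Complex.I * ξ

/-- The discriminant of the characteristic polynomial of the equation, after a Fourier transform
in `y`. -/
noncomputable def disc (kx ky ε ν : ℝ) (ξ : ℝ) : ℂ :=
  (-kx ^ 2 + 4 * Real.pi * ε * ky * ξ : ℝ) - (2 * ε * ky ^ 2 * ν : ℝ) * Complex.I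

/-- The square root of the discriminant with positive real part. -/
noncomputable def root (kx ky ε ν : ℝ) (ξ : ℝ) : ℂ := disc kx ky ε ν ξ ^ (2⁻¹ : ℂ)

/-- The decaying characteristic exponent. -/
noncomputable def lamM (kx ky ε ν : ℝ) (ξ : ℝ) : ℂ :=
  (-Complex.I * kx + kx * ky * ε * derivSymbol ξ - root kx ky ε ν ξ) / (ε * ky ^ 2)

/-- The growing characteristic exponent. -/
noncomputable def lamP (kx ky ε ν : ℝ) (ξ : ℝ) : ℂ :=
  (-Complex.I * kx + kx * ky * ε * derivSymbol ξ + root kx ky ε ν ξ) / (ε * ky ^ 2)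

/-- The symbol of the boundary condition on decaying solutions. -/
noncomputable def boundarySymbol (kx ky ε ν : ℝ) (ξ : ℝ) : ℂ :=
  kx + Complex.I * root kx ky ε ν ξ

/-- The multiplier giving the trace of the solution from the entrance datum. -/
noncomputable def traceSymbol (kx ky ε ν : ℝ) (ξ : ℝ) : ℂ :=
  2 * kx * (boundarySymbol kx ky ε ν ξ)⁻¹

theorem hasTemperateGrowth_derivSymbol : derivSymbol.HasTemperateGrowth := by
  unfold derivSymbol
  fun_prop

namespace IsAdmissible

variable {kx ky ε ν : ℝ} (h : IsAdmissible kx ky ε ν)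
include h

theorem root_sq (ξ : ℝ) : root kx ky ε ν ξ ^ 2 = disc kx ky ε ν ξ := by
  have := Complex.cpow_nat_inv_pow (disc kx ky ε ν ξ) (n := 2) two_ne_zero
  simpa only [root, Nat.cast_ofNat] using this

theorem sq_ky_pos : 0 < ky ^ 2 := by
  have := h.ky_ne
  positivity

theorem damping_pos : 0 < ε * ky ^ 2 * ν :=
  mul_pos (mul_pos h.eps_pos h.sq_ky_pos) h.nu_pos

theorem disc_im (ξ : ℝ) : (disc kx ky ε ν ξ).im = -(2 * (ε * ky ^ 2 * ν)) := by
  simp [disc, -Complex.ofReal_mul, -Complex.ofReal_pow, -Complex.ofReal_add]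
  ring

theorem re_mul_im_root (ξ : ℝ) :
    (root kx ky ε ν ξ).re * (root kx ky ε ν ξ).im = -(ε * ky ^ 2 * ν) := by
  have h1 := congrArg Complex.im (h.root_sq ξ)
  rw [h.disc_im, sq, Complex.mul_im] at h1
  linarith

/-- The principal root has argument in `[-π/2, π/2]`, so its real part is nonnegative; it cannot
vanish because the product of real and imaginary parts is nonzero. -/
theorem root_re_pos (ξ : ℝ) : 0 < (root kx ky ε ν ξ).re := by
  have h0 : 0 ≤ (root kx ky ε ν ξ).re := by
    have hd : disc kx ky ε ν ξ ≠ 0 := by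
      intro h0
      have := h.disc_im ξ
      rw [h0, Complex.zero_im] at this
      linarith [h.damping_pos]
    rw [root, Complex.cpow_def_of_ne_zero hd, Complex.exp_re]
    have him : (Complex.log (disc kx ky ε ν ξ) * 2⁻¹).im = (disc kx ky ε ν ξ).arg / 2 := by
      rw [show (2⁻¹ : ℂ) = ((2⁻¹ : ℝ) : ℂ) by norm_num, Complex.im_mul_ofReal, Complex.log_im]
      ring
    rw [him]
    refine mul_nonneg (Real.exp_pos _).le (Real.cos_nonneg_of_neg_pi_div_two_le_of_le ?_ ?_)
    · linarith [Complex.neg_pi_lt_arg (disc kx ky ε ν ξ)]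
    · linarith [Complex.arg_le_pi (disc kx ky ε ν ξ)]
  refine lt_of_le_of_ne h0 fun h1 => ?_
  have := h.re_mul_im_root ξ
  rw [← h1, zero_mul] at this
  linarith [h.damping_pos]

theorem root_im_neg (ξ : ℝ) : (root kx ky ε ν ξ).im < 0 := by
  have h1 := h.re_mul_im_root ξ
  have h2 := h.root_re_pos ξ
  have h3 := h.damping_pos
  by_contra! h4
  nlinarith [mul_nonneg h2.le h4]

theorem root_ne_zero (ξ : ℝ) : root kx ky ε ν ξ ≠ 0 := by
  intro h0
  have := h.root_re_pos ξ
  rw [h0] at this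
  simp at this

theorem boundarySymbol_re (ξ : ℝ) :
    (boundarySymbol kx ky ε ν ξ).re = kx - (root kx ky ε ν ξ).im := by
  simp [boundarySymbol]
  ring

theorem boundarySymbol_im (ξ : ℝ) :
    (boundarySymbol kx ky ε ν ξ).im = (root kx ky ε ν ξ).re := by
  simp [boundarySymbol]

theorem kx_le_norm_boundarySymbol (ξ : ℝ) : kx ≤ ‖boundarySymbol kx ky ε ν ξ‖ := by
  refine le_trans ?_ (Complex.re_le_norm _)
  rw [h.boundarySymbol_re]
  linarith [h.root_im_neg ξ]

/-- The boundary symbol has real part `kx - Im r` and imaginary part `Re r`. Since `kx > 0` and `Im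
r < 0`, the two terms of the real part do not cancel. -/
theorem norm_root_le_norm_boundarySymbol (ξ : ℝ) :
    ‖root kx ky ε ν ξ‖ ≤ ‖boundarySymbol kx ky ε ν ξ‖ := by
  rw [Complex.norm_def, Complex.norm_def]
  refine Real.sqrt_le_sqrt ?_
  rw [Complex.normSq_apply, Complex.normSq_apply, h.boundarySymbol_re, h.boundarySymbol_im]
  nlinarith [h.root_im_neg ξ, h.kx_pos]

theorem boundarySymbol_ne_zero (ξ : ℝ) : boundarySymbol kx ky ε ν ξ ≠ 0 := by
  intro h0
  have := h.kx_le_norm_boundarySymbol ξ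
  rw [h0, norm_zero] at this
  linarith [h.kx_pos]

theorem hasDerivAt_disc (ξ : ℝ) :
    HasDerivAt (disc kx ky ε ν) ((4 * Real.pi * ε * ky : ℝ) : ℂ) ξ := by
  have h1 : HasDerivAt (fun ξ : ℝ => -kx ^ 2 + 4 * Real.pi * ε * ky * ξ)
      (4 * Real.pi * ε * ky * 1) ξ := ((hasDerivAt_id ξ).const_mul _).const_add _
  rw [mul_one] at h1
  exact h1.ofReal_comp.sub_const _

theorem hasTemperateGrowth_disc : (disc kx ky ε ν).HasTemperateGrowth := by
  unfold disc
  push_cast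
  fun_prop

theorem hasDerivAt_root (ξ : ℝ) : HasDerivAt (root kx ky ε ν)
    ((4 * Real.pi * ε * ky : ℝ) / 2 * (root kx ky ε ν ξ)⁻¹) ξ := by
  -- The nonzero imaginary part keeps the discriminant off the branch cut.
  have hs : disc kx ky ε ν ξ ∈ Complex.slitPlane := by
    right
    rw [h.disc_im]
    linarith [h.damping_pos]
  have h1 := (HasDerivAt.cpow_const (c := (2⁻¹ : ℂ)) (hasDerivAt_id (disc kx ky ε ν ξ))
    hs).comp_of_eq ξ (h.hasDerivAt_disc ξ) rfl
  refine HasDerivAt.congr_deriv h1 ?_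
  have hd : disc kx ky ε ν ξ ≠ 0 := Complex.slitPlane_ne_zero hs
  simp only [id]
  rw [Complex.cpow_sub _ _ hd, Complex.cpow_one, ← root, ← h.root_sq ξ]
  field_simp [h.root_ne_zero ξ]

theorem norm_root_sq (ξ : ℝ) : ‖root kx ky ε ν ξ‖ ^ 2 = ‖disc kx ky ε ν ξ‖ := by
  rw [← norm_pow, h.root_sq]

theorem norm_inv_root_le (ξ : ℝ) :
    ‖(root kx ky ε ν ξ)⁻¹‖ ≤ (Real.sqrt (2 * (ε * ky ^ 2 * ν)))⁻¹ := by
  have hp := h.damping_pos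
  rw [norm_inv]
  refine inv_anti₀ (by positivity) (Real.sqrt_le_iff.2 ⟨norm_nonneg _, ?_⟩)
  rw [h.norm_root_sq]
  refine le_trans ?_ (Complex.abs_im_le_norm _)
  rw [h.disc_im, abs_neg]
  exact le_abs_self _

theorem hasTemperateGrowth_inv_root : (fun ξ => (root kx ky ε ν ξ)⁻¹).HasTemperateGrowth := by
  have hd := fun ξ => (h.hasDerivAt_root ξ).fun_inv (h.root_ne_zero ξ)
  refine .of_deriv_closed (fun ξ => (hd ξ).differentiableAt) h.norm_inv_root_le fun n hn => ?_
  have h1 := ((TemperateFamily.of_hasTemperateGrowth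
    (Function.HasTemperateGrowth.const (-((4 * Real.pi * ε * ky : ℝ) / 2 : ℂ))) n).mul
      ((hn.mul hn).mul hn)).mono_weight (κ' := fun _ => 1) (by simp)
  convert h1 using 3 with _ ξ
  rw [(hd ξ).deriv]
  field_simp [h.root_ne_zero ξ]

theorem hasTemperateGrowth_root : (root kx ky ε ν).HasTemperateGrowth := by
  have := h.hasTemperateGrowth_disc.mul h.hasTemperateGrowth_inv_root
  have e : root kx ky ε ν = disc kx ky ε ν * fun ξ => (root kx ky ε ν ξ)⁻¹ := by
    funext ξ
    have := h.root_ne_zero ξ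
    rw [Pi.mul_apply, ← h.root_sq ξ]
    field_simp
  rw [e]
  exact this

theorem hasTemperateGrowth_inv_boundarySymbol :
    (fun ξ => (boundarySymbol kx ky ε ν ξ)⁻¹).HasTemperateGrowth := by
  have hd := fun ξ => (((h.hasDerivAt_root ξ).const_mul Complex.I).const_add
    (kx : ℂ)).fun_inv (h.boundarySymbol_ne_zero ξ)
  refine .of_deriv_closed (C := kx⁻¹) (fun ξ => (hd ξ).differentiableAt) (fun ξ => ?_)
    fun n hn => ?_
  · rw [norm_inv]
    exact inv_anti₀ h.kx_pos (h.kx_le_norm_boundarySymbol ξ)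
  · have h1 := ((TemperateFamily.of_hasTemperateGrowth
      ((Function.HasTemperateGrowth.const
        (-(Complex.I * ((4 * Real.pi * ε * ky : ℝ) / 2) : ℂ))).mul
          h.hasTemperateGrowth_inv_root) n).mul (hn.mul hn)).mono_weight
        (κ' := fun _ => 1) (by simp)
    convert h1 using 3 with _ ξ
    refine (hd ξ).deriv.trans ?_
    change _ / boundarySymbol kx ky ε ν ξ ^ 2 = _
    have := h.boundarySymbol_ne_zero ξ
    have := h.root_ne_zero ξ
    simp only [Pi.mul_apply]
    field_simp

theorem hasTemperateGrowth_traceSymbol : (traceSymbol kx ky ε ν).HasTemperateGrowth :=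
  (Function.HasTemperateGrowth.const (2 * kx : ℂ)).mul h.hasTemperateGrowth_inv_boundarySymbol

theorem hasTemperateGrowth_lamM : (lamM kx ky ε ν).HasTemperateGrowth := by
  have := h.hasTemperateGrowth_root
  have := hasTemperateGrowth_derivSymbol
  unfold lamM
  simp only [div_eq_mul_inv]
  fun_prop

theorem hasTemperateGrowth_lamP : (lamP kx ky ε ν).HasTemperateGrowth := by
  have := h.hasTemperateGrowth_root
  have := hasTemperateGrowth_derivSymbol
  unfold lamP
  simp only [div_eq_mul_inv]
  fun_prop

theorem lamM_re (ξ : ℝ) : (lamM kx ky ε ν ξ).re = -((root kx ky ε ν ξ).re / (ε * ky ^ 2)) := by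
  rw [lamM, show (ε * ky ^ 2 : ℂ) = ((ε * ky ^ 2 : ℝ) : ℂ) by push_cast; rfl,
    Complex.div_ofReal_re, ← neg_div]
  congr 1
  simp [derivSymbol, ← Complex.ofReal_mul]

theorem lamP_re (ξ : ℝ) : (lamP kx ky ε ν ξ).re = (root kx ky ε ν ξ).re / (ε * ky ^ 2) := by
  rw [lamP, show (ε * ky ^ 2 : ℂ) = ((ε * ky ^ 2 : ℝ) : ℂ) by push_cast; rfl,
    Complex.div_ofReal_re]
  congr 1
  simp [derivSymbol, ← Complex.ofReal_mul]

/-- `Re r · |Im r|` equals the constant `εky²ν`, while `|Im r| ≤ |r|` grows polynomially, so `Re r`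
cannot be smaller than an inverse power of `1 + |ξ|`. This bound degenerates as `ν → 0`, but it
enters only qualitative statements. -/
theorem isDecayExponent_of_re {a : ℝ → ℂ} (ha : a.HasTemperateGrowth)
    (hre : ∀ ξ, (a ξ).re = -((root kx ky ε ν ξ).re / (ε * ky ^ 2))) : IsDecayExponent a where
  temperate := ha
  neg ξ := by
    rw [hre, neg_lt_zero]
    exact div_pos (h.root_re_pos ξ) (mul_pos h.eps_pos h.sq_ky_pos)
  lower := by
    obtain ⟨k, C, hC, hb⟩ := h.hasTemperateGrowth_root.norm_iteratedFDeriv_le_uniform 0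
    refine ⟨k, C / ν, div_nonneg hC h.nu_pos.le, fun ξ => ?_⟩
    have h1 := hb 0 le_rfl ξ
    rw [norm_iteratedFDeriv_zero] at h1
    have h2 := h.re_mul_im_root ξ
    have h3 := (Complex.abs_im_le_norm (root kx ky ε ν ξ)).trans h1
    rw [abs_of_neg (h.root_im_neg ξ)] at h3
    have h4 := h.root_re_pos ξ
    have h5 := mul_pos h.eps_pos h.sq_ky_pos
    have h6 := h.nu_pos
    rw [hre, neg_neg]
    rw [show C / ν * (1 + ‖ξ‖) ^ k * ((root kx ky ε ν ξ).re / (ε * ky ^ 2)) =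
      ((root kx ky ε ν ξ).re * (C * (1 + ‖ξ‖) ^ k)) / (ε * ky ^ 2 * ν) by field_simp,
      le_div_iff₀ h.damping_pos, one_mul]
    nlinarith [mul_le_mul_of_nonneg_left h3 h4.le]

theorem isDecayExponent_lamM : IsDecayExponent (lamM kx ky ε ν) :=
  h.isDecayExponent_of_re h.hasTemperateGrowth_lamM h.lamM_re

theorem isDecayExponent_neg_lamP : IsDecayExponent (fun ξ => -lamP kx ky ε ν ξ) :=
  h.isDecayExponent_of_re h.hasTemperateGrowth_lamP.neg fun ξ => by
    rw [Complex.neg_re, h.lamP_re]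

theorem lamM_add_lamP (ξ : ℝ) : (ε / 2 : ℂ) * ky ^ 2 * (lamM kx ky ε ν ξ + lamP kx ky ε ν ξ) =
    -(Complex.I * kx) + ε * kx * ky * derivSymbol ξ := by
  have h1 : (ky : ℂ) ≠ 0 := mod_cast h.ky_ne
  have h2 : (ε : ℂ) ≠ 0 := mod_cast h.eps_pos.ne'
  rw [lamM, lamP]
  field_simp
  ring

theorem lamM_mul_lamP (ξ : ℝ) : (ε / 2 : ℂ) * ky ^ 2 * (lamM kx ky ε ν ξ * lamP kx ky ε ν ξ) =
    Complex.I * ky * derivSymbol ξ + ε / 2 * kx ^ 2 * derivSymbol ξ ^ 2 + Complex.I * ν := by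
  have h1 : (ky : ℂ) ≠ 0 := mod_cast h.ky_ne
  have h2 : (ε : ℂ) ≠ 0 := mod_cast h.eps_pos.ne'
  have h3 := h.root_sq ξ
  have h4 : (kx : ℂ) ^ 2 = 1 - ky ^ 2 := by
    have := h.unit
    rw [eq_sub_iff_add_eq]
    exact_mod_cast this
  have h5 : (lamM kx ky ε ν ξ * lamP kx ky ε ν ξ) = ((-Complex.I * kx + kx * ky * ε *
      derivSymbol ξ) ^ 2 - disc kx ky ε ν ξ) / (ε * ky ^ 2) ^ 2 := by
    rw [← h3, lamM, lamP]
    field_simp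
    ring
  rw [h5, disc, derivSymbol]
  push_cast
  field_simp
  ring_nf
  simp only [Complex.I_sq]
  ring_nf
  simp only [h4]
  ring

theorem boundarySymbol_eq (ξ : ℝ) : boundarySymbol kx ky ε ν ξ =
    Complex.I * ε * ky * (kx * derivSymbol ξ - ky * lamM kx ky ε ν ξ) + 2 * kx := by
  have h1 : (ky : ℂ) ≠ 0 := mod_cast h.ky_ne
  have h2 : (ε : ℂ) ≠ 0 := mod_cast h.eps_pos.ne'
  rw [boundarySymbol, lamM, derivSymbol]
  field_simp
  ring_nf
  simp only [Complex.I_sq]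
  ring

theorem boundarySymbol_mul_traceSymbol (ξ : ℝ) :
    boundarySymbol kx ky ε ν ξ * traceSymbol kx ky ε ν ξ = 2 * kx := by
  have := h.boundarySymbol_ne_zero ξ
  rw [traceSymbol]
  field_simp

/-- The quantitative heart of the result. With `D` the modulus of the boundary symbol, `D²`
dominates both `kx²` and a multiple of `|ξ|`, so `D⁴` dominates `1 + ξ²`. The damping has
disappeared from the constant because only the real part of the discriminant is used. -/
theorem norm_traceSymbol_le (ξ : ℝ) : ‖traceSymbol kx ky ε ν ξ‖ * (1 + ξ ^ 2) ^ (1 / 4 : ℝ) ≤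
    2 * kx * ((kx ^ 4)⁻¹ + ((2 * Real.pi * ε * ky) ^ 2)⁻¹) ^ (1 / 4 : ℝ) := by
  have hk := h.kx_pos
  have hy := h.ky_ne
  have he := h.eps_pos
  have hpi := Real.pi_pos
  set D := ‖boundarySymbol kx ky ε ν ξ‖ with hD
  have hD0 : 0 < D := hk.trans_le (h.kx_le_norm_boundarySymbol ξ)
  have h1 : kx ^ 2 ≤ D ^ 2 := by
    have := h.kx_le_norm_boundarySymbol ξ
    gcongr
  have h2 : |2 * Real.pi * ε * ky| * |ξ| ≤ D ^ 2 := by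
    have h3 : ‖disc kx ky ε ν ξ‖ ≤ D ^ 2 := by
      rw [← h.norm_root_sq]
      have := h.norm_root_le_norm_boundarySymbol ξ
      gcongr
    have h4 := (Complex.abs_re_le_norm _).trans h3
    have h5 : (disc kx ky ε ν ξ).re = 2 * (2 * Real.pi * ε * ky * ξ) - kx ^ 2 := by
      simp [disc, -Complex.ofReal_mul, -Complex.ofReal_pow, -Complex.ofReal_add]
      ring
    rw [h5] at h4
    rw [← abs_mul]
    have h6 := abs_le.1 h4
    -- With `X = 2πεkyξ`, the bounds `|2X - kx²| ≤ D²` and `kx² ≤ D²` give `|X| ≤ D²`. This also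
    -- covers the frequencies where the real part of the discriminant vanishes.
    refine abs_le.2 ⟨by nlinarith, by nlinarith⟩
  have h3 : 1 + ξ ^ 2 ≤ ((kx ^ 4)⁻¹ + ((2 * Real.pi * ε * ky) ^ 2)⁻¹) * D ^ 4 := by
    have e1 : 1 ≤ (kx ^ 4)⁻¹ * D ^ 4 := by
      rw [inv_mul_eq_div, le_div_iff₀ (by positivity), one_mul]
      calc kx ^ 4 = (kx ^ 2) ^ 2 := by ring
        _ ≤ (D ^ 2) ^ 2 := by gcongr
        _ = _ := by ring
    have e2 : ξ ^ 2 ≤ ((2 * Real.pi * ε * ky) ^ 2)⁻¹ * D ^ 4 := by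
      rw [inv_mul_eq_div, le_div_iff₀ (by positivity)]
      calc ξ ^ 2 * (2 * Real.pi * ε * ky) ^ 2 = (|2 * Real.pi * ε * ky| * |ξ|) ^ 2 := by
            rw [← abs_mul, sq_abs]
            ring
        _ ≤ (D ^ 2) ^ 2 := by gcongr
        _ = _ := by ring
    linarith
  have h4 : (1 + ξ ^ 2) ^ (1 / 4 : ℝ) ≤
      ((kx ^ 4)⁻¹ + ((2 * Real.pi * ε * ky) ^ 2)⁻¹) ^ (1 / 4 : ℝ) * D := by
    refine (Real.rpow_le_rpow (by positivity) h3 (by norm_num)).trans_eq ?_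
    rw [Real.mul_rpow (by positivity) (by positivity), ← Real.rpow_natCast D 4,
      ← Real.rpow_mul hD0.le]
    norm_num
  have h5 : ‖traceSymbol kx ky ε ν ξ‖ = 2 * kx * D⁻¹ := by
    rw [traceSymbol, norm_mul, norm_mul, norm_inv, Complex.norm_real, Real.norm_of_nonneg hk.le,
      Complex.norm_two]
  rw [h5]
  calc _ ≤ 2 * kx * D⁻¹ *
      (((kx ^ 4)⁻¹ + ((2 * Real.pi * ε * ky) ^ 2)⁻¹) ^ (1 / 4 : ℝ) * D) := by gcongr
    _ = _ := by field_simp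

end IsAdmissible

end TiltedParaxial

/-! ### Translations, slices and tensor products of Schwartz functions -/

theorem norm_iteratedFDeriv_comp_clm_le {E F G : Type*} [NormedAddCommGroup E] [NormedSpace ℝ E]
    [NormedAddCommGroup F] [NormedSpace ℝ F] [NormedAddCommGroup G] [NormedSpace ℝ G]
    {f : F → G} (L : E →L[ℝ] F) (hL : ‖L‖ ≤ 1) {n : ℕ} (hf : ContDiff ℝ n f) (x : E) :
    ‖iteratedFDeriv ℝ n (fun x => f (L x)) x‖ ≤ ‖iteratedFDeriv ℝ n f (L x)‖ := by
  have := L.iteratedFDeriv_comp_right hf x (i := n) le_rfl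
  rw [show (fun x => f (L x)) = f ∘ L from rfl, this]
  refine (ContinuousMultilinearMap.norm_compContinuousLinearMap_le _ _).trans ?_
  refine mul_le_of_le_one_right (norm_nonneg _) ?_
  exact Finset.prod_le_one (fun _ _ => norm_nonneg _) fun _ _ => hL

namespace SchwartzMap

variable {E : Type*} [NormedAddCommGroup E] [NormedSpace ℝ E]

theorem norms_translate_le (N : ℕ) (a : E) (Φ : 𝓢(E, ℂ)) :
    norms E N (Φ.compSubConstCLM ℂ a) ≤ (1 + ‖a‖) ^ N * (2 ^ N * norms E N Φ) := by
  have hN := apply_nonneg (norms E N) Φ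
  rw [norms_le_iff (by positivity)]
  intro k hk n hn
  refine seminorm_le_bound ℂ k n _ (by positivity) fun x => ?_
  rw [show ⇑(Φ.compSubConstCLM ℂ a) = fun x => Φ (x - a) from rfl, iteratedFDeriv_comp_sub]
  have h1 : ‖x‖ ≤ (1 + ‖a‖) * (1 + ‖x - a‖) := by
    have := norm_le_norm_sub_add x a
    nlinarith [norm_nonneg a, norm_nonneg (x - a), mul_nonneg (norm_nonneg a) (norm_nonneg (x - a))]
  calc ‖x‖ ^ k * ‖iteratedFDeriv ℝ n Φ (x - a)‖
      ≤ ((1 + ‖a‖) * (1 + ‖x - a‖)) ^ k * ‖iteratedFDeriv ℝ n Φ (x - a)‖ := by gcongr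
    _ = (1 + ‖a‖) ^ k * ((1 + ‖x - a‖) ^ k * ‖iteratedFDeriv ℝ n Φ (x - a)‖) := by
        rw [mul_pow, mul_assoc]
    _ ≤ (1 + ‖a‖) ^ N * (2 ^ N * norms E N Φ) := by
        gcongr ?_ * ?_
        · exact pow_le_pow_right₀ (by simp) hk
        · exact one_add_pow_mul_le_norms hk hn Φ _

theorem norms_sub_translate_le (N : ℕ) (a : E) (Φ : 𝓢(E, ℂ)) :
    norms E N (Φ - Φ.compSubConstCLM ℂ a) ≤
      (1 + ‖a‖) ^ N * (2 ^ (N + 1) * norms E (N + 1) Φ) * ‖a‖ := by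
  have hN := apply_nonneg (norms E (N + 1)) Φ
  rw [norms_le_iff (by positivity)]
  intro k hk n hn
  refine seminorm_le_bound ℂ k n _ (by positivity) fun x => ?_
  have e1 : ⇑(Φ - Φ.compSubConstCLM ℂ a) = Φ - fun x => Φ (x - a) := by
    ext x
    simp
  have hc : ContDiff ℝ n Φ := Φ.smooth n
  have hc' : ContDiff ℝ n fun x => Φ (x - a) := hc.comp (contDiff_id.sub contDiff_const)
  rw [e1, iteratedFDeriv_sub hc hc', Pi.sub_apply, iteratedFDeriv_comp_sub]
  -- The weight is frozen at the endpoint `x`, so the mean value inequality differentiates only `Φ`;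
  -- one more derivative is used, hence `N + 1`.
  have hmv := Convex.norm_image_sub_le_of_norm_fderiv_le (𝕜 := ℝ) (f := fun z => (‖x‖ ^ k) •
    iteratedFDeriv ℝ n Φ z) (s := segment ℝ (x - a) x) (x := x - a) (y := x)
    (C := (1 + ‖a‖) ^ N * (2 ^ (N + 1) * norms E (N + 1) Φ))
    (fun z _ => ((Φ.smooth ⊤).differentiable_iteratedFDeriv (m := n) (mod_cast
      WithTop.coe_lt_top _) z).fun_const_smul _)
    (fun z hz => by
      rw [fderiv_fun_const_smul ((Φ.smooth ⊤).differentiable_iteratedFDeriv (m := n) (mod_cast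
        WithTop.coe_lt_top _) z), norm_smul, norm_pow, norm_norm, norm_fderiv_iteratedFDeriv]
      have hz' : ‖x - z‖ ≤ ‖a‖ := by
        rw [segment_symm] at hz
        have := norm_sub_le_of_mem_segment hz
        rw [norm_sub_rev]
        simpa using this
      have h1 : ‖x‖ ≤ (1 + ‖a‖) * (1 + ‖z‖) := by
        have := norm_le_norm_sub_add x z
        nlinarith [norm_nonneg a, norm_nonneg z, mul_nonneg (norm_nonneg a) (norm_nonneg z)]
      calc ‖x‖ ^ k * ‖iteratedFDeriv ℝ (n + 1) Φ z‖
          ≤ ((1 + ‖a‖) * (1 + ‖z‖)) ^ k * ‖iteratedFDeriv ℝ (n + 1) Φ z‖ := by gcongr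
        _ = (1 + ‖a‖) ^ k * ((1 + ‖z‖) ^ k * ‖iteratedFDeriv ℝ (n + 1) Φ z‖) := by
            rw [mul_pow, mul_assoc]
        _ ≤ (1 + ‖a‖) ^ N * (2 ^ (N + 1) * norms E (N + 1) Φ) := by
            gcongr ?_ * ?_
            · exact pow_le_pow_right₀ (by simp) hk
            · exact one_add_pow_mul_le_norms (by omega) (by omega) Φ _)
    (convex_segment _ _) (left_mem_segment _ _ _) (right_mem_segment _ _ _)
  rw [← smul_sub, norm_smul, norm_pow, norm_norm, sub_sub_cancel] at hmv
  exact hmv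

/-- Since `|x| ≤ ‖(x, y)‖`, two spare powers of the weight become decay in `x`, which makes pairings
of a bounded curve with slices integrable. -/
theorem norms_slice_le (N : ℕ) (Φ : 𝓢(ℝ × ℝ, ℂ)) (x : ℝ) :
    (1 + |x|) ^ 2 * norms ℝ N (schwartzSlice Φ x) ≤
      2 ^ (N + 2) * norms (ℝ × ℝ) (N + 2) Φ := by
  have hN := apply_nonneg (norms (ℝ × ℝ) (N + 2)) Φ
  rw [mul_comm, ← le_div_iff₀ (by positivity), norms_le_iff (by positivity)]
  intro k hk n hn
  refine seminorm_le_bound ℂ k n _ (by positivity) fun y => ?_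
  have e1 : ⇑(schwartzSlice Φ x) = fun y =>
      (fun z => Φ ((x, 0) + z)) (ContinuousLinearMap.inr ℝ ℝ ℝ y) := by
    ext y
    simp [schwartzSlice_apply]
  have hc : ContDiff ℝ n fun z => Φ ((x, 0) + z) :=
    (Φ.smooth n).comp (contDiff_const.add contDiff_id)
  have h1 : ‖iteratedFDeriv ℝ n (schwartzSlice Φ x) y‖ ≤ ‖iteratedFDeriv ℝ n Φ (x, y)‖ := by
    rw [e1]
    refine (norm_iteratedFDeriv_comp_clm_le _ (ContinuousLinearMap.norm_inr_le_one ℝ ℝ ℝ)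
      hc y).trans_eq ?_
    rw [iteratedFDeriv_comp_add_left]
    simp
  have h2 : |x| ≤ ‖(x, y)‖ := norm_fst_le (x, y)
  have h3 : ‖y‖ ≤ 1 + ‖(x, y)‖ := (norm_snd_le (x, y)).trans (by simp)
  rw [le_div_iff₀ (by positivity)]
  calc ‖y‖ ^ k * ‖iteratedFDeriv ℝ n (schwartzSlice Φ x) y‖ * (1 + |x|) ^ 2
      ≤ (1 + ‖(x, y)‖) ^ k * ‖iteratedFDeriv ℝ n Φ (x, y)‖ * (1 + ‖(x, y)‖) ^ 2 := by gcongr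
    _ = (1 + ‖(x, y)‖) ^ (k + 2) * ‖iteratedFDeriv ℝ n Φ (x, y)‖ := by ring
    _ ≤ _ := one_add_pow_mul_le_norms (by omega) (by omega) Φ _

theorem schwartzSlice_sub_eq (Φ : 𝓢(ℝ × ℝ, ℂ)) (x t : ℝ) :
    schwartzSlice Φ x - schwartzSlice Φ t =
      schwartzSlice (Φ - Φ.compSubConstCLM ℂ ((x - t, 0) : ℝ × ℝ)) x := by
  ext y
  simp [schwartzSlice_apply]

/-- Moving the slice is the same as translating `Φ`, so the Lipschitz bound for translations
applies. -/
theorem norms_slice_sub_le (N : ℕ) (Φ : 𝓢(ℝ × ℝ, ℂ)) : ∃ C, 0 ≤ C ∧ ∀ x t, |x - t| ≤ 1 →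
    norms ℝ N (schwartzSlice Φ x - schwartzSlice Φ t) ≤ C * |x - t| := by
  refine ⟨2 ^ (N + 2) * (2 ^ (N + 2) * (2 ^ (N + 3) * norms (ℝ × ℝ) (N + 3) Φ)), ?_,
    fun x t h => ?_⟩
  · have hN := apply_nonneg (norms (ℝ × ℝ) (N + 3)) Φ
    positivity
  have hN := apply_nonneg (norms (ℝ × ℝ) (N + 3)) Φ
  rw [schwartzSlice_sub_eq]
  set Ψ := Φ - Φ.compSubConstCLM ℂ ((x - t, 0) : ℝ × ℝ)
  have h1 := norms_slice_le N Ψ x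
  have h2 := norms_sub_translate_le (N + 2) ((x - t, 0) : ℝ × ℝ) Φ
  have h3 : ‖((x - t, 0) : ℝ × ℝ)‖ = |x - t| := by simp [Prod.norm_def]
  rw [h3] at h2
  have h4 : norms ℝ N (schwartzSlice Ψ x) ≤ (1 + |x|) ^ 2 * norms ℝ N (schwartzSlice Ψ x) :=
    le_mul_of_one_le_left (apply_nonneg _ _) (one_le_pow₀ (by simp))
  have h5 : (1 + |x - t|) ^ (N + 2) ≤ 2 ^ (N + 2) := by
    gcongr
    linarith
  calc _ ≤ 2 ^ (N + 2) * norms (ℝ × ℝ) (N + 2) Ψ := h4.trans h1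
    _ ≤ 2 ^ (N + 2) * ((1 + |x - t|) ^ (N + 2) * (2 ^ (N + 3) * norms (ℝ × ℝ) (N + 3) Φ) *
      |x - t|) := by gcongr
    _ ≤ 2 ^ (N + 2) * (2 ^ (N + 2) * (2 ^ (N + 3) * norms (ℝ × ℝ) (N + 3) Φ) *
      |x - t|) := by gcongr
    _ = _ := by ring

/-- The tensor product `(x, y) ↦ ρ(x) φ(y)` of Schwartz functions. -/
noncomputable def tensorCLM (ρ : 𝓢(ℝ, ℂ)) : 𝓢(ℝ, ℂ) →L[ℂ] 𝓢(ℝ × ℝ, ℂ) :=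
  mkCLM (fun φ z => ρ z.1 * φ z.2) (fun _ _ _ => by simp [mul_add])
    (fun _ _ _ => by simp [mul_left_comm])
    (fun φ => ((ρ.smooth ⊤).comp contDiff_fst).mul ((φ.smooth ⊤).comp contDiff_snd)) <| by
  rintro ⟨k, n⟩
  refine ⟨Finset.Iic (k + n, k + n), 2 ^ n * (2 ^ (k + n) * norms ℝ (k + n) ρ * 2 ^ (k + n)), ?_,
    fun φ z => ?_⟩
  · have hN := apply_nonneg (norms ℝ (k + n)) ρ
    positivity
  change _ ≤ _ * norms ℝ (k + n) φ
  have h1 : ‖z‖ ≤ (1 + ‖z.1‖) * (1 + ‖z.2‖) := by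
    rw [Prod.norm_def]
    have h3 := norm_nonneg z.1
    have h4 := norm_nonneg z.2
    exact max_le (by nlinarith) (by nlinarith)
  have key : ∀ j ∈ Finset.range (n + 1), (n.choose j : ℝ) *
      ‖iteratedFDeriv ℝ j (fun z : ℝ × ℝ => ρ z.1) z‖ *
      ‖iteratedFDeriv ℝ (n - j) (fun z : ℝ × ℝ => φ z.2) z‖ ≤
      (n.choose j : ℝ) * (‖iteratedFDeriv ℝ j ρ z.1‖ * ‖iteratedFDeriv ℝ (n - j) φ z.2‖) := by
    intro j hj
    rw [mul_assoc]
    gcongr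
    · exact norm_iteratedFDeriv_comp_clm_le (ContinuousLinearMap.fst ℝ ℝ ℝ)
        (ContinuousLinearMap.norm_fst_le ℝ ℝ ℝ) (ρ.smooth j) z
    · exact norm_iteratedFDeriv_comp_clm_le (ContinuousLinearMap.snd ℝ ℝ ℝ)
        (ContinuousLinearMap.norm_snd_le ℝ ℝ ℝ) (φ.smooth (n - j : ℕ)) z
  have hρ := apply_nonneg (norms ℝ (k + n)) ρ
  calc ‖z‖ ^ k * ‖iteratedFDeriv ℝ n (fun z : ℝ × ℝ => ρ z.1 * φ z.2) z‖
      ≤ ((1 + ‖z.1‖) * (1 + ‖z.2‖)) ^ k * ∑ j ∈ Finset.range (n + 1), (n.choose j : ℝ) *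
        (‖iteratedFDeriv ℝ j ρ z.1‖ * ‖iteratedFDeriv ℝ (n - j) φ z.2‖) := by
        gcongr
        exact (norm_iteratedFDeriv_mul_le ((ρ.smooth ⊤).comp contDiff_fst)
          ((φ.smooth ⊤).comp contDiff_snd) z (mod_cast le_top)).trans (Finset.sum_le_sum key)
    _ ≤ ∑ j ∈ Finset.range (n + 1), (n.choose j : ℝ) *
        ((2 ^ (k + n) * norms ℝ (k + n) ρ) * (2 ^ (k + n) * norms ℝ (k + n) φ)) := by
        rw [Finset.mul_sum]
        refine Finset.sum_le_sum fun j hj => ?_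
        rw [Finset.mem_range_succ_iff] at hj
        have e1 := one_add_pow_mul_le_norms (k := k) (n := j) (N := k + n)
          (by omega) (by omega) ρ z.1
        have e2 := one_add_pow_mul_le_norms (k := k) (n := n - j) (N := k + n)
          (by omega) (by omega) φ z.2
        calc _ = (n.choose j : ℝ) * (((1 + ‖z.1‖) ^ k * ‖iteratedFDeriv ℝ j ρ z.1‖) *
              ((1 + ‖z.2‖) ^ k * ‖iteratedFDeriv ℝ (n - j) φ z.2‖)) := by
                rw [mul_pow]
                ring
          _ ≤ _ := by gcongr
    _ = _ := by
        rw [← Finset.sum_mul]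
        have h2 : (∑ l ∈ Finset.range (n + 1), (n.choose l : ℝ)) = 2 ^ n := by
          exact_mod_cast Nat.sum_range_choose n
        rw [h2]
        ring

end SchwartzMap

/-! ### Differentiation and transport along exponential flows -/

section

open SchwartzMap (norms)

theorem hasDerivWithinAt_of_quadratic {f f' : ℝ → ℂ} {S : Set ℝ} {C : ℝ}
    (h : ∀ s ∈ S, ∀ t ∈ S, ‖f t - f s - (t - s) • f' s‖ ≤ C * |t - s| ^ 2) {s : ℝ} (hs : s ∈ S) :
    HasDerivWithinAt f (f' s) S s := by
  rw [hasDerivWithinAt_iff_isLittleO]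
  have h1 : (fun t => f t - f s - (t - s) • f' s) =O[𝓝[S] s] fun t => (t - s) ^ 2 := by
    refine Asymptotics.IsBigO.of_bound C ?_
    filter_upwards [self_mem_nhdsWithin] with t ht
    simpa using h s hs t ht
  refine h1.trans_isLittleO ?_
  have h2 : (fun t : ℝ => t - s) =o[𝓝[S] s] fun _ => (1 : ℝ) := by
    rw [Asymptotics.isLittleO_one_iff]
    have : Tendsto (fun t : ℝ => t - s) (𝓝 s) (𝓝 (s - s)) :=
      (continuous_id.sub continuous_const).tendsto s
    rw [sub_self] at this
    exact this.mono_left nhdsWithin_le_nhds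
  simpa [sq] using h2.mul_isBigO (Asymptotics.isBigO_refl (fun t : ℝ => t - s) _)

/-- Differentiation maps the family to itself, so one derivative for every member gives all
derivatives. -/
theorem contDiffOn_of_hasDerivWithinAt_family {α : Type*} {A : α → α} {f : α → ℝ → ℂ}
    (h : ∀ ψ, ∀ x ∈ Ici (0 : ℝ), HasDerivWithinAt (f ψ) (f (A ψ) x) (Ici 0) x) (ψ : α) :
    ContDiffOn ℝ ∞ (f ψ) (Ici 0) := by
  have key : ∀ n : ℕ, ∀ ψ, ContDiffOn ℝ n (f ψ) (Ici 0) := by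
    intro n
    induction n with
    | zero => exact fun ψ => contDiffOn_zero.2 fun x hx => (h ψ x hx).continuousWithinAt
    | succ n ih =>
      intro ψ
      push_cast
      rw [contDiffOn_succ_iff_derivWithin (uniqueDiffOn_Ici 0)]
      refine ⟨fun x hx => (h ψ x hx).differentiableWithinAt, by simp, (ih (A ψ)).congr ?_⟩
      exact fun x hx => (h ψ x hx).derivWithin (uniqueDiffOn_Ici 0 x hx)
  exact contDiffOn_infty.2 fun n => key n ψ

/-- Bounds for a family of multipliers, in terms of a Schwartz norm on the target. -/
theorem TemperateFamily.exists_bound_comp {ι ι' : Type*} {κ : ι → ℝ} {m : ι → ℝ → ℂ} {κ' : ι' → ℝ}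
    {m' : ι' → ℝ → ℂ} (h : ∀ n, TemperateFamily n κ m) (h' : ∀ n, TemperateFamily n κ' m') (M : ℕ) :
    ∃ (N : ℕ) (C : ℝ), 0 ≤ C ∧ ∀ i i' (φ : 𝓢(ℝ, ℂ)),
      norms ℝ M (SchwartzMap.smulLeftCLM ℂ (m i) (SchwartzMap.smulLeftCLM ℂ (m' i') φ)) ≤
        C * κ i * κ' i' * norms ℝ N φ := by
  obtain ⟨N, C, hC, hb⟩ := exists_norms_smulLeftCLM_le h M
  obtain ⟨N', C', hC', hb'⟩ := exists_norms_smulLeftCLM_le h' N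
  refine ⟨N', C * C', by positivity, fun i i' φ => (hb i _).trans ?_⟩
  have := (h 0).nonneg i
  calc _ ≤ C * κ i * (C' * κ' i' * norms ℝ N' φ) := by gcongr; exact hb' i' φ
    _ = _ := by ring

namespace IsDecayExponent

variable {a : ℝ → ℂ} (ha : IsDecayExponent a)
include ha

theorem temperate_remainder (h : ℝ≥0) :
    (fun ξ => expMul a h ξ - 1 - (h : ℝ) * a ξ).HasTemperateGrowth :=
  TemperateFamily.hasTemperateGrowth ha.family_sub_one_sub h

theorem temperate_sub_one (h : ℝ≥0) : (fun ξ => expMul a h ξ - 1).HasTemperateGrowth :=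
  TemperateFamily.hasTemperateGrowth ha.family_sub_one h

/-- The semigroup law reduces everything to small increments `h`, where the second order remainder
has multiplier norm of order `h²`. The resulting Taylor estimate is uniform on the half-line. -/
theorem hasDerivWithinAt_smulLeftCLM (T : 𝓢(ℝ, ℂ) →L[ℂ] ℂ) (ψ : 𝓢(ℝ, ℂ)) {x : ℝ}
    (hx : x ∈ Ici (0 : ℝ)) :
    HasDerivWithinAt (fun x => T (SchwartzMap.smulLeftCLM ℂ (expMul a x.toNNReal) ψ))
      (T (SchwartzMap.smulLeftCLM ℂ (expMul a x.toNNReal) (SchwartzMap.smulLeftCLM ℂ a ψ)))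
      (Ici 0) x := by
  obtain ⟨M, C₀, hC₀, hT⟩ := SchwartzMap.exists_norm_le_norms T
  obtain ⟨N₁, C₁, hC₁, h₁⟩ := TemperateFamily.exists_bound_comp ha.family_sub_one_sub ha.family M
  obtain ⟨N₂, C₂, hC₂, h₂⟩ := TemperateFamily.exists_bound_comp ha.family_sub_one ha.family M
  set ψ' := SchwartzMap.smulLeftCLM ℂ a ψ with hψ'
  refine hasDerivWithinAt_of_quadratic (C := C₀ * (C₁ * norms ℝ N₁ ψ) + C₀ * (C₂ * norms ℝ N₂ ψ'))
    (f' := fun x => T (SchwartzMap.smulLeftCLM ℂ (expMul a x.toNNReal) ψ'))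
    (fun s hs t ht => ?_) hx
  rw [mem_Ici] at hs ht
  have p₁ := apply_nonneg (norms ℝ N₁) ψ
  have p₂ := apply_nonneg (norms ℝ N₂) ψ'
  have b₁ : ∀ (h r : ℝ≥0), ‖T (SchwartzMap.smulLeftCLM ℂ (fun ξ => expMul a h ξ - 1 - (h : ℝ) * a ξ)
      (SchwartzMap.smulLeftCLM ℂ (expMul a r) ψ))‖ ≤ C₀ * (C₁ * norms ℝ N₁ ψ) * (h : ℝ) ^ 2 := by
    intro h r
    refine (hT _).trans ?_
    calc _ ≤ C₀ * (C₁ * (h : ℝ) ^ 2 * 1 * norms ℝ N₁ ψ) := by gcongr; exact h₁ h r ψ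
      _ = _ := by ring
  have b₂ : ∀ (h r : ℝ≥0), ‖T (SchwartzMap.smulLeftCLM ℂ (fun ξ => expMul a h ξ - 1)
      (SchwartzMap.smulLeftCLM ℂ (expMul a r) ψ'))‖ ≤ C₀ * (C₂ * norms ℝ N₂ ψ') * (h : ℝ) := by
    intro h r
    refine (hT _).trans ?_
    calc _ ≤ C₀ * (C₂ * (h : ℝ) * 1 * norms ℝ N₂ ψ') := by gcongr; exact h₂ h r ψ'
      _ = _ := by ring
  rcases le_total s t with hst | hst
  · obtain ⟨h, rfl⟩ : ∃ h : ℝ≥0, t = s + h := ⟨(t - s).toNNReal, by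
      rw [Real.coe_toNNReal _ (by linarith)]
      ring⟩
    have e : (s + h).toNNReal = h + s.toNNReal := by
      rw [Real.toNNReal_add hs h.coe_nonneg, Real.toNNReal_coe, add_comm]
    have e2 : T (SchwartzMap.smulLeftCLM ℂ (expMul a (s + h).toNNReal) ψ) -
        T (SchwartzMap.smulLeftCLM ℂ (expMul a s.toNNReal) ψ) -
        (s + h - s) • T (SchwartzMap.smulLeftCLM ℂ (expMul a s.toNNReal) ψ') =
        T (SchwartzMap.smulLeftCLM ℂ (fun ξ => expMul a h ξ - 1 - (h : ℝ) * a ξ)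
          (SchwartzMap.smulLeftCLM ℂ (expMul a s.toNNReal) ψ)) := by
      rw [add_sub_cancel_left, ← Complex.coe_smul, ← map_smul, ← map_sub, ← map_sub]
      congr 1
      ext ξ
      simp [-SchwartzMap.smulLeftCLM_smulLeftCLM_apply, ha.temperate_expMul, ha.temperate, ha.temperate_remainder, hψ', e, expMul_add]
      ring
    rw [e2, add_sub_cancel_left, abs_of_nonneg h.coe_nonneg]
    refine (b₁ h _).trans ?_
    gcongr
    exact le_add_of_nonneg_right (by positivity)
  -- The exponentials are bounded only forward in time, so the expansion starts from the smaller
  -- time `t`; moving the derivative from `s` to `t` costs another term of order `h²`.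
  · obtain ⟨h, rfl⟩ : ∃ h : ℝ≥0, s = t + h := ⟨(s - t).toNNReal, by
      rw [Real.coe_toNNReal _ (by linarith)]
      ring⟩
    have e : (t + h).toNNReal = h + t.toNNReal := by
      rw [Real.toNNReal_add ht h.coe_nonneg, Real.toNNReal_coe, add_comm]
    have e2 : T (SchwartzMap.smulLeftCLM ℂ (expMul a t.toNNReal) ψ) -
        T (SchwartzMap.smulLeftCLM ℂ (expMul a (t + h).toNNReal) ψ) -
        (t - (t + h)) • T (SchwartzMap.smulLeftCLM ℂ (expMul a (t + h).toNNReal) ψ') =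
        (h : ℝ) • T (SchwartzMap.smulLeftCLM ℂ (fun ξ => expMul a h ξ - 1)
          (SchwartzMap.smulLeftCLM ℂ (expMul a t.toNNReal) ψ')) -
        T (SchwartzMap.smulLeftCLM ℂ (fun ξ => expMul a h ξ - 1 - (h : ℝ) * a ξ)
          (SchwartzMap.smulLeftCLM ℂ (expMul a t.toNNReal) ψ)) := by
      rw [sub_add_cancel_left, neg_smul, sub_neg_eq_add, ← Complex.coe_smul, ← Complex.coe_smul,
        ← map_smul T, ← map_smul T, ← map_sub T, ← map_add T, ← map_sub T]
      congr 1
      ext ξ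
      simp [-SchwartzMap.smulLeftCLM_smulLeftCLM_apply, ha.temperate_expMul, ha.temperate, ha.temperate_remainder, ha.temperate_sub_one, hψ',
        e, expMul_add]
      ring
    rw [e2, sub_add_cancel_left, abs_neg, abs_of_nonneg h.coe_nonneg]
    refine (norm_sub_le _ _).trans ?_
    rw [norm_smul, Real.norm_of_nonneg h.coe_nonneg]
    have c₁ := b₁ h t.toNNReal
    have c₂ := mul_le_mul_of_nonneg_left (b₂ h t.toNNReal) h.coe_nonneg
    nlinarith

/-- Transport of test functions along the flow of a first order equation: if
`∂ₜ Y = -Y ∘ b`, then `t ↦ Y(t)(exp (t b) ψ)` is constant. -/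
theorem propagation {Y : ℝ → 𝓢(ℝ, ℂ) →ₗ[ℂ] ℂ} {R : ℝ} (hR : 0 ≤ R) {M : ℕ} {C₀ : ℝ}
    (hY : ∀ t ∈ Icc 0 R, ∀ ψ, ‖Y t ψ‖ ≤ C₀ * norms ℝ M ψ)
    (hd : ∀ ψ, ∀ t ∈ Icc 0 R, HasDerivWithinAt (fun t => Y t ψ)
      (-Y t (SchwartzMap.smulLeftCLM ℂ a ψ)) (Icc 0 R) t) (ψ : 𝓢(ℝ, ℂ)) :
    Y R (SchwartzMap.smulLeftCLM ℂ (expMul a R.toNNReal) ψ) = Y 0 ψ := by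
  have hC₀' : ∀ t ∈ Icc 0 R, ∀ ψ, ‖Y t ψ‖ ≤ |C₀| * norms ℝ M ψ := fun t ht ψ =>
    (hY t ht ψ).trans (mul_le_mul_of_nonneg_right (le_abs_self _) (apply_nonneg _ _))
  obtain ⟨N₁, C₁, hC₁, h₁⟩ := TemperateFamily.exists_bound_comp ha.family_sub_one_sub ha.family M
  obtain ⟨N₂, C₂, hC₂, h₂⟩ := TemperateFamily.exists_norms_smulLeftCLM_le ha.family M
  set ψ₂ := SchwartzMap.smulLeftCLM ℂ a (SchwartzMap.smulLeftCLM ℂ a ψ) with hψ₂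
  have p₁ := apply_nonneg (norms ℝ N₁) ψ
  have p₂ := apply_nonneg (norms ℝ N₂) ψ₂
  set j : ℝ → ℂ := fun t => Y t (SchwartzMap.smulLeftCLM ℂ (expMul a t.toNNReal) ψ) with hj
  set K := |C₀| * (C₁ * norms ℝ N₁ ψ) + |C₀| * (C₂ * norms ℝ N₂ ψ₂) with hK
  -- Both the functional and the test function move with `t`. Instead of a product rule, the first
  -- order terms are shown to cancel, leaving a quadratic bound on the increment of `j`, whose
  -- derivative is therefore zero.
  have main : ∀ s ∈ Icc 0 R, ∀ t ∈ Icc 0 R, s ≤ t → ‖j t - j s‖ ≤ K * |t - s| ^ 2 := by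
    intro s hs t ht hst
    set χ := SchwartzMap.smulLeftCLM ℂ (expMul a s.toNNReal) ψ with hχ
    obtain ⟨h, hh⟩ : ∃ h : ℝ≥0, t = s + h := ⟨(t - s).toNNReal, by
      rw [Real.coe_toNNReal _ (by linarith)]
      ring⟩
    have e : t.toNNReal = h + s.toNNReal := by
      rw [hh, Real.toNNReal_add hs.1 h.coe_nonneg, Real.toNNReal_coe, add_comm]
    have sub : Icc s t ⊆ Icc 0 R := Icc_subset_Icc hs.1 ht.2
    have d₁ : ∀ r ∈ Icc s t, ‖Y r (SchwartzMap.smulLeftCLM ℂ a χ) -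
        Y t (SchwartzMap.smulLeftCLM ℂ a χ)‖ ≤ |C₀| * (C₂ * norms ℝ N₂ ψ₂) * ‖r - t‖ := by
      intro r hr
      refine Convex.norm_image_sub_le_of_norm_hasDerivWithin_le (𝕜 := ℝ) (s := Icc s t)
        (f := fun r => Y r (SchwartzMap.smulLeftCLM ℂ a χ))
        (fun r hr => (hd _ r (sub hr)).mono sub) (fun r hr => ?_) (convex_Icc _ _)
        (right_mem_Icc.2 hst) hr
      rw [norm_neg]
      have e3 : SchwartzMap.smulLeftCLM ℂ a (SchwartzMap.smulLeftCLM ℂ a χ) =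
          SchwartzMap.smulLeftCLM ℂ (expMul a s.toNNReal) ψ₂ := by
        ext ξ
        simp [-SchwartzMap.smulLeftCLM_smulLeftCLM_apply, ha.temperate_expMul, ha.temperate, hχ, hψ₂]
        ring
      rw [e3]
      refine (hC₀' r (sub hr) _).trans ?_
      have := h₂ s.toNNReal ψ₂
      rw [mul_one] at this
      gcongr
    -- Taylor expansion of `Y` based at the later time `t`, where the increment of the test function
    -- is also evaluated; the Lipschitz bound `d₁` controls the remainder.
    have d₂ : ‖(Y t χ + (t - s) • Y t (SchwartzMap.smulLeftCLM ℂ a χ)) - Y s χ‖ ≤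
        (|C₀| * (C₂ * norms ℝ N₂ ψ₂) * |t - s|) * ‖t - s‖ := by
      have hd2 : ∀ r ∈ Icc s t, HasDerivWithinAt
          (fun r => Y r χ + (r - s) • Y t (SchwartzMap.smulLeftCLM ℂ a χ))
          (-Y r (SchwartzMap.smulLeftCLM ℂ a χ) + Y t (SchwartzMap.smulLeftCLM ℂ a χ))
          (Icc s t) r := by
        intro r hr
        have := (((hasDerivAt_id r).sub_const s).smul_const
          (Y t (SchwartzMap.smulLeftCLM ℂ a χ))).hasDerivWithinAt (s := Icc s t)
        rw [one_smul] at this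
        exact ((hd _ r (sub hr)).mono sub).add this
      have := Convex.norm_image_sub_le_of_norm_hasDerivWithin_le (𝕜 := ℝ) (s := Icc s t)
        hd2 (C := |C₀| * (C₂ * norms ℝ N₂ ψ₂) * |t - s|) (fun r hr => by
          rw [neg_add_eq_sub, norm_sub_rev]
          refine (d₁ r hr).trans ?_
          gcongr ?_ * ?_
          rw [Real.norm_eq_abs, abs_sub_comm, abs_of_nonneg (by linarith [hr.2]),
            abs_of_nonneg (by linarith)]
          linarith [hr.1])
        (convex_Icc _ _) (left_mem_Icc.2 hst) (right_mem_Icc.2 hst)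
      simpa using this
    have d₃ : ‖Y t (SchwartzMap.smulLeftCLM ℂ (fun ξ => expMul a h ξ - 1 - (h : ℝ) * a ξ) χ)‖ ≤
        |C₀| * (C₁ * norms ℝ N₁ ψ) * |t - s| ^ 2 := by
      refine (hC₀' t ht _).trans ?_
      have := h₁ h s.toNNReal ψ
      rw [hh, add_sub_cancel_left, abs_of_nonneg h.coe_nonneg]
      calc _ ≤ |C₀| * (C₁ * (h : ℝ) ^ 2 * 1 * norms ℝ N₁ ψ) := by gcongr
        _ = _ := by ring
    have e4 : j t - j s =
        Y t (SchwartzMap.smulLeftCLM ℂ (fun ξ => expMul a h ξ - 1 - (h : ℝ) * a ξ) χ) +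
        ((Y t χ + (t - s) • Y t (SchwartzMap.smulLeftCLM ℂ a χ)) - Y s χ) := by
      rw [← add_sub_assoc]
      change Y t _ - Y s χ = _
      congr 1
      rw [← Complex.coe_smul, ← map_smul, ← map_add, ← map_add]
      congr 1
      ext ξ
      have : ((t - s : ℝ) : ℂ) = (h : ℝ) := by rw [hh, add_sub_cancel_left]
      simp [-SchwartzMap.smulLeftCLM_smulLeftCLM_apply, ha.temperate_expMul, ha.temperate, ha.temperate_remainder, hχ, e, expMul_add,
        -Complex.ofReal_sub, this]
      ring
    rw [e4]
    refine (norm_add_le _ _).trans ((add_le_add d₃ d₂).trans_eq ?_)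
    rw [hK, Real.norm_eq_abs]
    ring
  have hj0 : ∀ s ∈ Icc 0 R, HasDerivWithinAt j 0 (Icc 0 R) s := by
    intro s hs
    refine hasDerivWithinAt_of_quadratic (f' := fun _ => 0) (C := K) (fun s hs t ht => ?_) hs
    rw [smul_zero, sub_zero]
    rcases le_total s t with hst | hst
    · exact main s hs t ht hst
    · rw [norm_sub_rev, abs_sub_comm]
      exact main t ht s hs hst
  have := Convex.norm_image_sub_le_of_norm_hasDerivWithin_le (𝕜 := ℝ) hj0 (C := 0)
    (fun _ _ => by simp) (convex_Icc _ _) (left_mem_Icc.2 hR) (right_mem_Icc.2 hR)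
  rw [zero_mul, norm_le_zero_iff, sub_eq_zero] at this
  rw [show Y R (SchwartzMap.smulLeftCLM ℂ (expMul a R.toNNReal) ψ) = j R from rfl, this, hj]
  simp only [Real.toNNReal_zero]
  congr 1
  ext ξ
  simp [-SchwartzMap.smulLeftCLM_smulLeftCLM_apply, ha.temperate_expMul, expMul_zero]

end IsDecayExponent

/-! ### Existence: the solution as a Fourier multiplier -/

open FourierTransform

/-- A tempered distribution as a continuous linear functional. -/
noncomputable def TemperedDistribution.toFunctional {E : Type*} [NormedAddCommGroup E]
    [NormedSpace ℝ E] (w : 𝓢'(E, ℂ)) : 𝓢(E, ℂ) →L[ℂ] ℂ where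
  toFun φ := w φ
  map_add' := map_add w
  map_smul' := map_smul w
  cont := map_continuous w

theorem SchwartzMap.neg_derivCLM_fourier (ψ : 𝓢(ℝ, ℂ)) :
    -SchwartzMap.derivCLM ℂ ℂ (𝓕 ψ) =
      𝓕 (SchwartzMap.smulLeftCLM ℂ TiltedParaxial.derivSymbol ψ) := by
  have h1 : SchwartzMap.derivCLM ℂ ℂ (𝓕 ψ) = LineDeriv.lineDerivOp (1 : ℝ) (𝓕 ψ) := by
    ext x
    rw [SchwartzMap.derivCLM_apply, SchwartzMap.lineDerivOp_apply_eq_fderiv,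
      fderiv_apply_one_eq_deriv]
  have h2 : SchwartzMap.smulLeftCLM ℂ TiltedParaxial.derivSymbol ψ =
      (2 * Real.pi * Complex.I) • SchwartzMap.smulLeftCLM ℂ (inner ℝ · (1 : ℝ)) ψ := by
    ext ξ
    have : (inner ℝ · (1 : ℝ)).HasTemperateGrowth := by fun_prop
    rw [smul_apply, SchwartzMap.smulLeftCLM_apply_apply this,
      SchwartzMap.smulLeftCLM_apply_apply TiltedParaxial.hasTemperateGrowth_derivSymbol]
    simp [TiltedParaxial.derivSymbol, mul_assoc]
  rw [h1, h2, SchwartzMap.lineDerivOp_fourier_eq, neg_smul, FourierTransform.fourier_neg, neg_neg]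

theorem TemperedDistribution.derivCLM_fourier_apply (w : 𝓢'(ℝ, ℂ)) (ψ : 𝓢(ℝ, ℂ)) :
    derivCLM ℂ w (𝓕 ψ) =
      w (𝓕 (SchwartzMap.smulLeftCLM ℂ TiltedParaxial.derivSymbol ψ)) := by
  rw [derivCLM_apply_apply, SchwartzMap.neg_derivCLM_fourier]

namespace TiltedParaxial

/-- The solution of the half-plane problem. -/
noncomputable def solution (kx ky ε ν : ℝ) (g : 𝓢'(ℝ, ℂ)) (x : ℝ) : 𝓢'(ℝ, ℂ) :=
  fourierMultiplierCLM ℂ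
    (fun ξ => expMul (lamM kx ky ε ν) x.toNNReal ξ * traceSymbol kx ky ε ν ξ) g

/-- The pairing of the Fourier transform of the entrance trace of the solution with a test
function. -/
noncomputable def traceFunctional (kx ky ε ν : ℝ) (g : 𝓢'(ℝ, ℂ)) : 𝓢(ℝ, ℂ) →L[ℂ] ℂ :=
  g.toFunctional ∘L fourierCLM ℂ 𝓢(ℝ, ℂ) ∘L SchwartzMap.smulLeftCLM ℂ (traceSymbol kx ky ε ν)

theorem traceFunctional_apply (kx ky ε ν : ℝ) (g : 𝓢'(ℝ, ℂ)) (ψ : 𝓢(ℝ, ℂ)) :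
    traceFunctional kx ky ε ν g ψ =
      g (𝓕 (SchwartzMap.smulLeftCLM ℂ (traceSymbol kx ky ε ν) ψ)) := rfl

namespace IsAdmissible

variable {kx ky ε ν : ℝ} (h : IsAdmissible kx ky ε ν)
include h

theorem solution_apply (g : 𝓢'(ℝ, ℂ)) (x : ℝ) (φ : 𝓢(ℝ, ℂ)) :
    solution kx ky ε ν g x φ = traceFunctional kx ky ε ν g
      (SchwartzMap.smulLeftCLM ℂ (expMul (lamM kx ky ε ν) x.toNNReal) (𝓕⁻ φ)) := by
  rw [solution, fourierMultiplierCLM_apply_apply, traceFunctional_apply,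
    SchwartzMap.smulLeftCLM_smulLeftCLM_apply h.hasTemperateGrowth_traceSymbol
      (h.isDecayExponent_lamM.temperate_expMul _), mul_comm]
  rfl

theorem solution_fourier (g : 𝓢'(ℝ, ℂ)) (x : ℝ) (ψ : 𝓢(ℝ, ℂ)) :
    solution kx ky ε ν g x (𝓕 ψ) = traceFunctional kx ky ε ν g
      (SchwartzMap.smulLeftCLM ℂ (expMul (lamM kx ky ε ν) x.toNNReal) ψ) := by
  rw [h.solution_apply, fourierInv_fourier_eq]

theorem hasDerivWithinAt_solution (g : 𝓢'(ℝ, ℂ)) (ψ : 𝓢(ℝ, ℂ)) {x : ℝ} (hx : x ∈ Ici (0 : ℝ)) :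
    HasDerivWithinAt (fun x => solution kx ky ε ν g x (𝓕 ψ))
      (solution kx ky ε ν g x (𝓕 (SchwartzMap.smulLeftCLM ℂ (lamM kx ky ε ν) ψ))) (Ici 0) x := by
  simp only [h.solution_fourier]
  exact h.isDecayExponent_lamM.hasDerivWithinAt_smulLeftCLM _ ψ hx

theorem derivWithin_solution (g : 𝓢'(ℝ, ℂ)) (ψ : 𝓢(ℝ, ℂ)) {x : ℝ} (hx : x ∈ Ici (0 : ℝ)) :
    derivWithin (fun x => solution kx ky ε ν g x (𝓕 ψ)) (Ici 0) x =
      solution kx ky ε ν g x (𝓕 (SchwartzMap.smulLeftCLM ℂ (lamM kx ky ε ν) ψ)) :=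
  (h.hasDerivWithinAt_solution g ψ hx).derivWithin (uniqueDiffOn_Ici 0 x hx)

/-- Vieta's formulas: `λ² - (λ + μ)λ + λμ = 0`. -/
theorem charpoly_lamM (ξ : ℝ) :
    Complex.I * (kx * lamM kx ky ε ν ξ + ky * derivSymbol ξ) + (ε / 2 : ℂ) *
      ((kx : ℂ) ^ 2 * derivSymbol ξ ^ 2 - 2 * kx * ky * (derivSymbol ξ * lamM kx ky ε ν ξ) +
        (ky : ℂ) ^ 2 * lamM kx ky ε ν ξ ^ 2) + Complex.I * ν = 0 := by
  linear_combination -(h.lamM_mul_lamP ξ) + lamM kx ky ε ν ξ * h.lamM_add_lamP ξ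

theorem exists_solution_bound (g : 𝓢'(ℝ, ℂ)) : ∃ (N : ℕ) (C : ℝ), 0 ≤ C ∧ ∀ x φ,
    ‖solution kx ky ε ν g x φ‖ ≤ C * norms ℝ N φ := by
  obtain ⟨M, C₀, hC₀, h₀⟩ := SchwartzMap.exists_norm_le_norms (traceFunctional kx ky ε ν g)
  obtain ⟨N₁, C₁, hC₁, h₁⟩ :=
    TemperateFamily.exists_norms_smulLeftCLM_le h.isDecayExponent_lamM.family M
  obtain ⟨N, C₂, hC₂, h₂⟩ := SchwartzMap.exists_norms_le_norms
    (fourierInvCLM ℂ 𝓢(ℝ, ℂ) : 𝓢(ℝ, ℂ) →L[ℂ] 𝓢(ℝ, ℂ)) N₁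
  refine ⟨N, C₀ * (C₁ * C₂), by positivity, fun x φ => ?_⟩
  rw [h.solution_apply]
  calc _ ≤ C₀ * (C₁ * 1 * (C₂ * norms ℝ N φ)) := by
        refine (h₀ _).trans ?_
        gcongr
        refine (h₁ _ _).trans ?_
        gcongr
        exact h₂ φ
    _ = _ := by ring

/-- The distribution varies against a fixed slice, which is continuous; the variation of the slice
is absorbed by the bound on the distributions, uniform in `x`. -/
theorem continuousOn_solution_slice (g : 𝓢'(ℝ, ℂ)) (Φ : 𝓢(ℝ × ℝ, ℂ)) :
    ContinuousOn (fun x => solution kx ky ε ν g x (schwartzSlice Φ x)) (Ici 0) := by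
  intro x hx
  obtain ⟨N, C, hC, hb⟩ := h.exists_solution_bound g
  obtain ⟨K, hK, hs⟩ := SchwartzMap.norms_slice_sub_le N Φ
  have h1 : Tendsto (fun t => solution kx ky ε ν g t (schwartzSlice Φ x)) (𝓝[Ici 0] x)
      (𝓝 (solution kx ky ε ν g x (schwartzSlice Φ x))) := by
    have := (h.hasDerivWithinAt_solution g (𝓕⁻ (schwartzSlice Φ x)) hx).continuousWithinAt
    simp only [fourier_fourierInv_eq] at this
    exact this
  have h2 : Tendsto (fun t => solution kx ky ε ν g t (schwartzSlice Φ t - schwartzSlice Φ x))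
      (𝓝[Ici 0] x) (𝓝 0) := by
    refine squeeze_zero_norm' (a := fun t => C * (K * |t - x|)) ?_ ?_
    · filter_upwards [nhdsWithin_le_nhds (Metric.ball_mem_nhds x one_pos)] with t ht
      refine (hb _ _).trans ?_
      gcongr
      refine hs t x ?_
      rw [Metric.mem_ball, Real.dist_eq] at ht
      exact ht.le
    · have : Continuous fun t : ℝ => C * (K * |t - x|) := by fun_prop
      have := this.tendsto x
      simp only [sub_self, abs_zero, mul_zero] at this
      exact this.mono_left nhdsWithin_le_nhds
  have h3 := h1.add h2
  rw [add_zero] at h3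
  refine h3.congr fun t => ?_
  rw [← map_add, add_sub_cancel]

theorem isTempered_solution (g : 𝓢'(ℝ, ℂ)) :
    IsTemperedOnHalfPlane (solution kx ky ε ν g) := by
  obtain ⟨N, C, hC, hb⟩ := h.exists_solution_bound g
  have hb' : ∀ (Φ : 𝓢(ℝ × ℝ, ℂ)) (x : ℝ), ‖solution kx ky ε ν g x (schwartzSlice Φ x)‖ ≤
      (C * (2 ^ (N + 2) * norms (ℝ × ℝ) (N + 2) Φ)) * (1 + ‖x‖) ^ (-2 : ℝ) := by
    intro Φ x
    refine (hb _ _).trans ?_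
    rw [Real.rpow_neg (by positivity), Real.rpow_ofNat, mul_assoc]
    gcongr
    rw [le_mul_inv_iff₀ (by positivity), mul_comm]
    exact SchwartzMap.norms_slice_le N Φ x
  have hI : Integrable (fun x : ℝ => (1 + ‖x‖) ^ (-2 : ℝ)) (volume : Measure ℝ) :=
    integrable_one_add_norm (by simp)
  have hint : ∀ Φ : 𝓢(ℝ × ℝ, ℂ), Integrable
      (fun x => solution kx ky ε ν g x (schwartzSlice Φ x)) (volume.restrict (Ioi (0 : ℝ))) := by
    intro Φ
    refine Integrable.mono' (hI.restrict.const_mul _) ?_ (Eventually.of_forall (hb' Φ))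
    exact ((h.continuousOn_solution_slice g Φ).mono Ioi_subset_Ici_self).aestronglyMeasurable
      measurableSet_Ioi
  let V : 𝓢(ℝ × ℝ, ℂ) →L[ℂ] ℂ := SchwartzMap.mkCLMtoNormedSpace
    (fun Φ => ∫ x in Ioi (0 : ℝ), solution kx ky ε ν g x (schwartzSlice Φ x))
    (fun Φ Ψ => by
      rw [← integral_add (hint Φ) (hint Ψ)]
      congr 1
      ext x
      rw [← map_add]
      rfl)
    (fun c Φ => by
      rw [RingHom.id_apply, ← integral_smul]
      congr 1
      ext x
      rw [← map_smul]
      rfl)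
    ⟨Finset.Iic (N + 2, N + 2),
      C * 2 ^ (N + 2) * ∫ x in Ioi (0 : ℝ), (1 + ‖x‖) ^ (-2 : ℝ), by positivity, fun Φ => by
      refine (norm_integral_le_of_norm_le (hI.restrict.const_mul _)
        (Eventually.of_forall (hb' Φ))).trans_eq ?_
      rw [integral_const_mul]
      change _ = _ * norms (ℝ × ℝ) (N + 2) Φ
      ring⟩
  exact ⟨ContinuousLinearMap.toPointwiseConvergenceCLM _ _ _ _ V, fun Φ _ => rfl⟩

theorem isHalfPlaneSolution_solution (g : 𝓢'(ℝ, ℂ)) :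
    IsHalfPlaneSolution kx ky ε ν g (solution kx ky ε ν g) where
  smooth φ := by
    have := contDiffOn_of_hasDerivWithinAt_family
      (f := fun ψ x => solution kx ky ε ν g x (𝓕 ψ))
      (A := SchwartzMap.smulLeftCLM ℂ (lamM kx ky ε ν))
      (fun ψ x hx => h.hasDerivWithinAt_solution g ψ hx) (𝓕⁻ φ)
    simpa only [fourier_fourierInv_eq] using this
  tempered := h.isTempered_solution g
  equation x hx φ := by
    have hx' : x ∈ Ici (0 : ℝ) := Ioi_subset_Ici_self hx
    obtain ⟨ψ, rfl⟩ : ∃ ψ : 𝓢(ℝ, ℂ), φ = 𝓕 ψ := ⟨𝓕⁻ φ, (fourier_fourierInv_eq φ).symm⟩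
    have e2 : iteratedDerivWithin 2 (fun t => solution kx ky ε ν g t (𝓕 ψ)) (Ici 0) x =
        solution kx ky ε ν g x (𝓕 (SchwartzMap.smulLeftCLM ℂ (lamM kx ky ε ν)
          (SchwartzMap.smulLeftCLM ℂ (lamM kx ky ε ν) ψ))) := by
      rw [iteratedDerivWithin_succ, iteratedDerivWithin_one,
        ← h.derivWithin_solution g _ hx']
      exact derivWithin_congr (fun t ht => h.derivWithin_solution g ψ ht)
        (h.derivWithin_solution g ψ hx')
    have hp := hasTemperateGrowth_derivSymbol
    have hl := h.hasTemperateGrowth_lamM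
    have e3 : derivWithin (fun t => derivCLM ℂ (solution kx ky ε ν g t) (𝓕 ψ)) (Ici 0) x =
        solution kx ky ε ν g x (𝓕 (SchwartzMap.smulLeftCLM ℂ (lamM kx ky ε ν)
          (SchwartzMap.smulLeftCLM ℂ derivSymbol ψ))) := by
      simp only [derivCLM_fourier_apply]
      exact h.derivWithin_solution g _ hx'
    rw [e2, e3, h.derivWithin_solution g _ hx']
    simp only [derivCLM_fourier_apply, h.solution_fourier]
    set T := traceFunctional kx ky ε ν g ∘L
      SchwartzMap.smulLeftCLM ℂ (expMul (lamM kx ky ε ν) x.toNNReal) with hT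
    set P := SchwartzMap.smulLeftCLM ℂ derivSymbol with hP
    set A := SchwartzMap.smulLeftCLM ℂ (lamM kx ky ε ν) with hA
    have key : Complex.I • ((kx : ℂ) • A ψ + (ky : ℂ) • P ψ) + (ε / 2 : ℂ) •
        ((kx : ℂ) ^ 2 • P (P ψ) - (2 * kx * ky : ℂ) • A (P ψ) + (ky : ℂ) ^ 2 • A (A ψ)) +
        (Complex.I * ν) • ψ = 0 := by
      ext ξ
      simp only [hA, hP, add_apply, sub_apply, smul_apply,
        SchwartzMap.smulLeftCLM_apply_apply hp, SchwartzMap.smulLeftCLM_apply_apply hl,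
        smul_eq_mul, zero_apply]
      linear_combination ψ ξ * h.charpoly_lamM ξ
    have := congrArg T key
    simp only [map_add, map_sub, map_smul, smul_eq_mul, map_zero] at this
    exact this
  boundary φ := by
    have hx' : (0 : ℝ) ∈ Ici (0 : ℝ) := self_mem_Ici
    obtain ⟨ψ, rfl⟩ : ∃ ψ : 𝓢(ℝ, ℂ), φ = 𝓕 ψ := ⟨𝓕⁻ φ, (fourier_fourierInv_eq φ).symm⟩
    have hp := hasTemperateGrowth_derivSymbol
    have hl := h.hasTemperateGrowth_lamM
    have ht := h.hasTemperateGrowth_traceSymbol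
    rw [h.derivWithin_solution g _ hx']
    -- At `x = 0` the exponential is one, so the boundary condition is the identity `boundarySymbol
    -- * traceSymbol = 2 kx` applied to test functions.
    have key : (Complex.I * ε * ky) • ((kx : ℂ) • SchwartzMap.smulLeftCLM ℂ
          (traceSymbol kx ky ε ν) (SchwartzMap.smulLeftCLM ℂ derivSymbol ψ) -
        (ky : ℂ) • SchwartzMap.smulLeftCLM ℂ (traceSymbol kx ky ε ν)
          (SchwartzMap.smulLeftCLM ℂ (lamM kx ky ε ν) ψ)) +
        (2 * kx : ℂ) • SchwartzMap.smulLeftCLM ℂ (traceSymbol kx ky ε ν) ψ =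
        (2 * kx : ℂ) • ψ := by
      ext ξ
      simp only [add_apply, sub_apply, smul_apply,
        SchwartzMap.smulLeftCLM_apply_apply hp, SchwartzMap.smulLeftCLM_apply_apply hl,
        SchwartzMap.smulLeftCLM_apply_apply ht, smul_eq_mul]
      have h1 := h.boundarySymbol_mul_traceSymbol ξ
      rw [h.boundarySymbol_eq] at h1
      linear_combination ψ ξ * h1
    have e : ∀ χ, solution kx ky ε ν g 0 (𝓕 χ) =
        g.toFunctional (fourierCLM ℂ 𝓢(ℝ, ℂ) (SchwartzMap.smulLeftCLM ℂ
          (traceSymbol kx ky ε ν) χ)) := fun χ => by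
      rw [h.solution_fourier, Real.toNNReal_zero,
        show expMul (lamM kx ky ε ν) 0 = fun _ => 1 from funext (expMul_zero _)]
      simp [traceFunctional]
    simp only [derivCLM_fourier_apply, e]
    have := congrArg (g.toFunctional ∘L fourierCLM ℂ 𝓢(ℝ, ℂ)) key
    simp only [map_add, map_sub, map_smul, smul_eq_mul] at this
    exact this

end IsAdmissible

end TiltedParaxial

/-! ### Translated means on the half-line -/

/-- Smooth functions with compact support in the open half-line. -/
structure IsHalfLineTest (ρ : ℝ → ℂ) : Prop where
  smooth : ContDiff ℝ ∞ ρ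
  compact : HasCompactSupport ρ
  support : tsupport ρ ⊆ Ioi 0

/-- The mean of `F` against the weight `ρ`, translated by `R`. -/
noncomputable def translatedMean (ρ F : ℝ → ℂ) (R : ℝ) : ℂ := ∫ x, ρ x * F (x + R)

namespace IsHalfLineTest

variable {ρ : ℝ → ℂ} (hρ : IsHalfLineTest ρ)
include hρ

theorem eq_zero_of_nonpos {x : ℝ} (hx : x ≤ 0) : ρ x = 0 :=
  image_eq_zero_of_notMem_tsupport fun h => (hρ.support h).not_ge hx

theorem deriv : IsHalfLineTest (deriv ρ) where
  smooth := (contDiff_infty_iff_deriv.1 hρ.smooth).2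
  compact := hρ.compact.deriv
  support := (tsupport_deriv_subset (𝕜 := ℝ)).trans hρ.support

theorem continuous_mul {F : ℝ → ℂ} (hF : ContinuousOn F (Ioi 0)) {R : ℝ} (hR : 0 ≤ R) :
    Continuous fun x => ρ x * F (x + R) := by
  refine continuous_iff_continuousAt.2 fun x => ?_
  by_cases hx : x ∈ tsupport ρ
  · refine hρ.smooth.continuous.continuousAt.mul ?_
    have hx0 : 0 < x := hρ.support hx
    have : ContinuousAt F (x + R) := hF.continuousAt (Ioi_mem_nhds (by linarith))
    exact this.comp (f := fun x => x + R) (by fun_prop)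
  · have : (fun x => ρ x * F (x + R)) =ᶠ[𝓝 x] fun _ => 0 := by
      filter_upwards [notMem_tsupport_iff_eventuallyEq.1 hx] with y hy
      rw [hy, Pi.zero_apply, zero_mul]
    exact continuousAt_const.congr this.symm

theorem integrable_mul {F : ℝ → ℂ} (hF : ContinuousOn F (Ioi 0)) {R : ℝ} (hR : 0 ≤ R) :
    Integrable fun x => ρ x * F (x + R) :=
  (hρ.continuous_mul hF hR).integrable_of_hasCompactSupport hρ.compact.mul_right

/-- Integration by parts without boundary term, since `ρ` vanishes near the origin and near
infinity. -/
theorem translatedMean_deriv {F F' : ℝ → ℂ} (hF : ∀ x ∈ Ioi (0 : ℝ), HasDerivAt F (F' x) x)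
    (hF' : ContinuousOn F' (Ioi 0)) {R : ℝ} (hR : 0 ≤ R) :
    translatedMean ρ F' R = -translatedMean (_root_.deriv ρ) F R := by
  have hFc : ContinuousOn F (Ioi 0) := fun x hx => (hF x hx).continuousAt.continuousWithinAt
  have i₁ := hρ.integrable_mul hF' hR
  have i₂ := hρ.deriv.integrable_mul hFc hR
  have h0 := integral_eq_zero_of_hasDerivAt_of_integrable (f := fun x => ρ x * F (x + R))
    (f' := fun x => _root_.deriv ρ x * F (x + R) + ρ x * F' (x + R)) (fun x => by
      by_cases hx : x ∈ tsupport ρ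
      · have hx0 : 0 < x := hρ.support hx
        exact ((hρ.smooth.differentiable (by simp)) x).hasDerivAt.mul
          ((hF (x + R) (by rw [mem_Ioi]; linarith)).comp_add_const x R)
      · have e : ρ =ᶠ[𝓝 x] 0 := notMem_tsupport_iff_eventuallyEq.1 hx
        rw [e.deriv_eq, e.eq_of_nhds]
        have : (fun x => ρ x * F (x + R)) =ᶠ[𝓝 x] fun _ => 0 := by
          filter_upwards [e] with y hy
          rw [hy, Pi.zero_apply, zero_mul]
        simpa using (hasDerivAt_const x (0 : ℂ)).congr_of_eventuallyEq this)
    (i₂.add i₁) (hρ.integrable_mul hFc hR)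
  rw [integral_add i₂ i₁] at h0
  exact eq_neg_of_add_eq_zero_right h0

theorem hasDerivWithinAt_translatedMean {F F' : ℝ → ℂ} (hc : ContinuousOn F (Ici 0))
    (hF : ∀ x ∈ Ioi (0 : ℝ), HasDerivAt F (F' x) x) (hF' : ContinuousOn F' (Ioi 0))
    {R : ℝ} (hR : R ∈ Ici (0 : ℝ)) :
    HasDerivWithinAt (translatedMean ρ F) (translatedMean ρ F' R) (Ici 0) R := by
  set F₀ := (Ici (0 : ℝ)).indicator F with hF₀
  have hloc : LocallyIntegrable F₀ := by
    refine locallyIntegrable_iff.2 fun K hK => ?_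
    rw [hF₀, IntegrableOn, integrable_indicator_iff measurableSet_Ici, IntegrableOn,
      Measure.restrict_restrict measurableSet_Ici]
    exact (hc.mono inter_subset_left).integrableOn_compact (hK.inter_left isClosed_Ici)
  have conv : ∀ {σ : ℝ → ℂ}, IsHalfLineTest σ → ∀ S ∈ Ici (0 : ℝ),
      translatedMean σ F S = ∫ t, σ (-t) * F₀ (S - t) := by
    intro σ hσ S hS
    rw [translatedMean, ← integral_neg_eq_self]
    congr 1
    ext t
    rw [neg_add_eq_sub]
    rcases le_or_gt 0 t with ht | ht
    · rw [hσ.eq_zero_of_nonpos (by linarith), zero_mul, zero_mul]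
    · rw [hF₀, indicator_of_mem]
      rw [mem_Ici] at hS ⊢
      linarith
  have hcs : HasCompactSupport fun t => ρ (-t) :=
    hρ.compact.comp_homeomorph (Homeomorph.neg ℝ)
  -- The mean is a convolution with `ρ(-·)`, and the derivative falls on that smooth factor. The
  -- extension `F₀` only has to be locally integrable, so its possible jump at `0` does no harm,
  -- even at `R = 0`.
  have hd := hcs.hasDerivAt_convolution_left (ContinuousLinearMap.mul ℝ ℂ)
    ((hρ.smooth.comp contDiff_neg).of_le (by simp)) hloc R
  rw [hρ.translatedMean_deriv hF hF' hR, conv hρ.deriv R hR, ← integral_neg]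
  refine (hd.hasDerivWithinAt.congr (fun S hS => conv hρ S hS) (conv hρ R hR)).congr_deriv ?_
  rw [convolution_def]
  congr 1
  ext t
  rw [show (fun t => ρ (-t)) = ρ ∘ Neg.neg from rfl]
  simp [deriv_comp_neg, Function.comp_def]

end IsHalfLineTest

/-- The fundamental lemma of the calculus of variations, followed by continuity to pass from almost
every point to every point. -/
theorem eq_zero_of_translatedMean_eq_zero {F : ℝ → ℂ} (hF : ContinuousOn F (Ioi 0)) {R : ℝ}
    (hR : 0 ≤ R) (h : ∀ ρ, IsHalfLineTest ρ → translatedMean ρ F R = 0) {x : ℝ} (hx : 0 < x) :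
    F (x + R) = 0 := by
  have hc : ContinuousOn (fun x => F (x + R)) (Ioi 0) :=
    hF.comp (by fun_prop) fun y hy => by rw [mem_Ioi] at hy ⊢; linarith
  have hae := isOpen_Ioi.ae_eq_zero_of_integral_contDiff_smul_eq_zero (μ := volume)
    (hc.locallyIntegrableOn measurableSet_Ioi) fun g hg hgc hgs => by
      have hs : Function.support (fun x => (g x : ℂ)) = Function.support g := by
        ext
        simp
      have := h (fun x => (g x : ℂ)) ⟨Complex.ofRealCLM.contDiff.comp hg,
        hgc.comp_left (g := fun r : ℝ => (r : ℂ)) rfl, by rwa [tsupport, hs]⟩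
      simpa [translatedMean] using this
  exact Measure.eqOn_open_of_ae_eq ((ae_restrict_iff' measurableSet_Ioi).2 hae) isOpen_Ioi hc
    continuousOn_const hx

/-! ### Tempered families of curves under first order flows -/

/-- A linear family of continuous functions on the half-line, whose means against test functions
grow temperately. -/
structure TemperedCurveFamily (Z : 𝓢(ℝ, ℂ) →ₗ[ℂ] (ℝ → ℂ)) : Prop where
  continuousOn : ∀ ψ, ContinuousOn (Z ψ) (Ici 0)
  bound : ∀ ρ, IsHalfLineTest ρ → ∃ (N : ℕ) (C : ℝ), 0 ≤ C ∧ ∀ R, 0 ≤ R → ∀ ψ,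
    ‖translatedMean ρ (Z ψ) R‖ ≤ C * (1 + R) ^ N * norms ℝ N ψ

namespace TemperedCurveFamily

variable {Z : 𝓢(ℝ, ℂ) →ₗ[ℂ] (ℝ → ℂ)} (hZ : TemperedCurveFamily Z)

/-- The means of a family of curves, as a linear form. -/
noncomputable def meanForm (hZ : TemperedCurveFamily Z) {ρ : ℝ → ℂ} (hρ : IsHalfLineTest ρ)
    {R : ℝ} (hR : 0 ≤ R) : 𝓢(ℝ, ℂ) →ₗ[ℂ] ℂ where
  toFun ψ := translatedMean ρ (Z ψ) R
  map_add' ψ χ := by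
    have i := fun ψ => hρ.integrable_mul ((hZ.continuousOn ψ).mono Ioi_subset_Ici_self) hR
    simp only [translatedMean, map_add, Pi.add_apply, mul_add]
    exact integral_add (i ψ) (i χ)
  map_smul' c ψ := by
    simp only [translatedMean, map_smul, Pi.smul_apply, smul_eq_mul, RingHom.id_apply,
      mul_left_comm _ c]
    exact integral_const_mul _ _

include hZ

/-- A tempered family of curves transported by an exponentially growing flow vanishes. -/
theorem eq_zero_of_growing {a : ℝ → ℂ} (ha : IsDecayExponent fun ξ => -a ξ)
    (hd : ∀ ψ, ∀ x ∈ Ioi (0 : ℝ),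
      HasDerivAt (Z ψ) (Z (SchwartzMap.smulLeftCLM ℂ a ψ) x) x) (ψ : 𝓢(ℝ, ℂ)) :
    ∀ x ∈ Ici (0 : ℝ), Z ψ x = 0 := by
  have hz : ∀ x ∈ Ioi (0 : ℝ), Z ψ x = 0 := by
    intro x hx
    rw [← add_zero x]
    refine eq_zero_of_translatedMean_eq_zero ((hZ.continuousOn ψ).mono Ioi_subset_Ici_self) le_rfl
      (fun ρ hρ => ?_) hx
    obtain ⟨N, C, hC, hb⟩ := hZ.bound ρ hρ
    -- Decay of order `N + 1` beats the growth `(1 + R)^N` of the means by one power, and `R → ∞`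
    -- then forces the mean at `0` to vanish.
    obtain ⟨N', C', hC', hb'⟩ := TemperateFamily.exists_norms_smulLeftCLM_le
      (fun n => ha.family_decay n (N + 1)) N
    have hp : ∀ R, 0 ≤ R → translatedMean ρ (Z ψ) 0 = translatedMean ρ
        (Z (SchwartzMap.smulLeftCLM ℂ (expMul (fun ξ => -a ξ) R.toNNReal) ψ)) R := by
      intro R hR
      have := ha.propagation (Y := fun t => hZ.meanForm hρ (le_max_right t 0)) (R := R) hR
        (M := N) (C₀ := C * (1 + R) ^ N) (fun t ht χ => by
          change ‖translatedMean ρ (Z χ) (max t 0)‖ ≤ _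
          refine (hb _ (le_max_right t 0) χ).trans ?_
          gcongr
          exact max_le ht.2 hR) (fun χ t ht => by
          have h1 := hρ.hasDerivWithinAt_translatedMean (hZ.continuousOn χ) (hd χ)
            ((hZ.continuousOn _).mono Ioi_subset_Ici_self) (R := t) ht.1
          refine ((h1.mono Icc_subset_Ici_self).congr (fun s hs => ?_) ?_).congr_deriv ?_
          · change translatedMean ρ (Z χ) (max s 0) = _
            rw [max_eq_left hs.1]
          · change translatedMean ρ (Z χ) (max t 0) = _
            rw [max_eq_left ht.1]
          · rw [← map_neg]
            change _ = translatedMean ρ (Z _) (max t 0)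
            rw [max_eq_left ht.1]
            congr 2
            have hat : a.HasTemperateGrowth := by
              have := ha.temperate.neg
              simpa [Pi.neg_def] using this
            ext ξ
            rw [neg_apply, SchwartzMap.smulLeftCLM_apply_apply hat,
              SchwartzMap.smulLeftCLM_apply_apply ha.temperate]
            simp) ψ
      change translatedMean ρ (Z _) (max R 0) = translatedMean ρ (Z ψ) (max 0 0) at this
      rw [max_eq_left hR, max_self] at this
      exact this.symm
    have hb2 : ∀ R, 0 ≤ R → ‖translatedMean ρ (Z ψ) 0‖ ≤ C * C' * norms ℝ N' ψ * (1 + R)⁻¹ := by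
      intro R hR
      rw [hp R hR]
      refine (hb R hR _).trans ?_
      have := hb' R.toNNReal ψ
      rw [Real.coe_toNNReal _ hR] at this
      calc _ ≤ C * (1 + R) ^ N * (C' * ((1 + R) ^ (N + 1))⁻¹ * norms ℝ N' ψ) := by gcongr
        _ = _ := by
          field_simp
          ring
    have hlim : Tendsto (fun R : ℝ => C * C' * norms ℝ N' ψ * (1 + R)⁻¹) atTop (𝓝 0) := by
      have := (tendsto_inv_atTop_zero.comp (tendsto_atTop_add_const_left atTop (1 : ℝ)
        tendsto_id)).const_mul (C * C' * norms ℝ N' ψ)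
      simpa using this
    exact norm_le_zero_iff.1 (ge_of_tendsto hlim ((eventually_ge_atTop 0).mono hb2))
  have hcl : EqOn (Z ψ) (fun _ => 0) (Ici 0) :=
    (show EqOn (Z ψ) (fun _ => 0) (Ioi 0) from hz).of_subset_closure (hZ.continuousOn ψ)
      continuousOn_const Ioi_subset_Ici_self (by rw [closure_Ioi])
  exact hcl

/-- A tempered family of curves transported by a decaying flow is determined by its initial
values. -/
theorem eq_of_decaying {a : ℝ → ℂ} (ha : IsDecayExponent a)
    (hd : ∀ ψ, ∀ x ∈ Ioi (0 : ℝ),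
      HasDerivAt (Z ψ) (Z (SchwartzMap.smulLeftCLM ℂ a ψ) x) x) (ψ : 𝓢(ℝ, ℂ)) :
    ∀ x ∈ Ici (0 : ℝ), Z ψ x = Z (SchwartzMap.smulLeftCLM ℂ (expMul a x.toNNReal) ψ) 0 := by
  intro R hR
  rw [mem_Ici] at hR
  set χ₀ := SchwartzMap.smulLeftCLM ℂ (expMul a R.toNNReal) ψ with hχ₀
  have hc := fun ψ => (hZ.continuousOn ψ).mono Ioi_subset_Ici_self
  have hcR : ContinuousOn (fun x => Z ψ (x + R)) (Ici 0) :=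
    (hZ.continuousOn ψ).comp (by fun_prop) fun y hy => by rw [mem_Ici] at hy ⊢; linarith
  have hz : ∀ x ∈ Ioi (0 : ℝ), Z ψ (x + R) - Z χ₀ x = 0 := by
    intro x hx
    have := eq_zero_of_translatedMean_eq_zero (F := fun x => Z ψ (x + R) - Z χ₀ x) (R := 0)
      (x := x) ((hcR.mono Ioi_subset_Ici_self).sub (hc _)) le_rfl (fun ρ hρ => ?_) hx
    · simpa using this
    obtain ⟨N, C, hC, hb⟩ := hZ.bound ρ hρ
    -- Time is reversed: the means at `R - t` satisfy the equation with the sign required by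
    -- `propagation`, and the decaying exponential carries the test function from time `R` back to
    -- time `0`.
    have hp := ha.propagation (Y := fun t => hZ.meanForm hρ (le_max_right (R - t) 0)) (R := R) hR
        (M := N) (C₀ := C * (1 + R) ^ N) (fun t ht χ => by
          change ‖translatedMean ρ (Z χ) (max (R - t) 0)‖ ≤ _
          refine (hb _ (le_max_right _ 0) χ).trans ?_
          gcongr
          exact max_le (by linarith [ht.1]) hR) (fun χ t ht => by
          have h1 := hρ.hasDerivWithinAt_translatedMean (hZ.continuousOn χ) (hd χ)
            (hc _) (R := R - t) (by rw [mem_Ici]; linarith [ht.2])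
          have h2 : HasDerivWithinAt (fun t => R - t) (-1) (Icc 0 R) t := by
            simpa using ((hasDerivAt_id t).const_sub R).hasDerivWithinAt (s := Icc 0 R)
          have h3 := h1.scomp t h2 fun s hs => by rw [mem_Ici]; linarith [hs.2]
          refine (h3.congr (fun s hs => ?_) ?_).congr_deriv ?_
          · change translatedMean ρ (Z χ) (max (R - s) 0) = _
            rw [max_eq_left (by linarith [hs.2])]
            rfl
          · change translatedMean ρ (Z χ) (max (R - t) 0) = _
            rw [max_eq_left (by linarith [ht.2])]
            rfl
          · change _ = -translatedMean ρ (Z _) (max (R - t) 0)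
            rw [max_eq_left (by linarith [ht.2]), neg_one_smul]) ψ
    change translatedMean ρ (Z χ₀) (max (R - R) 0) = translatedMean ρ (Z ψ) (max (R - 0) 0) at hp
    rw [sub_self, sub_zero, max_self, max_eq_left hR] at hp
    have e : translatedMean ρ (fun x => Z ψ (x + R) - Z χ₀ x) 0 =
        translatedMean ρ (Z ψ) R - translatedMean ρ (Z χ₀) 0 := by
      rw [translatedMean, translatedMean, translatedMean,
        ← integral_sub (hρ.integrable_mul (hc ψ) hR) (hρ.integrable_mul (hc χ₀) le_rfl)]
      simp only [add_zero, mul_sub]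
    rw [e, hp, sub_self]
  have hcl : EqOn (fun x => Z ψ (x + R) - Z χ₀ x) (fun _ => 0) (Ici 0) :=
    (show EqOn (fun x => Z ψ (x + R) - Z χ₀ x) (fun _ => 0) (Ioi 0) from hz).of_subset_closure
      (hcR.sub (hZ.continuousOn χ₀)) continuousOn_const Ioi_subset_Ici_self (by rw [closure_Ioi])
  have := hcl (self_mem_Ici : (0 : ℝ) ∈ Ici 0)
  simpa [sub_eq_zero] using this

end TemperedCurveFamily

namespace TemperedCurveFamily

variable {Z W : 𝓢(ℝ, ℂ) →ₗ[ℂ] (ℝ → ℂ)}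

theorem comp (hZ : TemperedCurveFamily Z) (T : 𝓢(ℝ, ℂ) →L[ℂ] 𝓢(ℝ, ℂ)) :
    TemperedCurveFamily (Z ∘ₗ T.toLinearMap) where
  continuousOn ψ := hZ.continuousOn (T ψ)
  bound ρ hρ := by
    obtain ⟨N, C, hC, hb⟩ := hZ.bound ρ hρ
    obtain ⟨N', C', hC', hb'⟩ := SchwartzMap.exists_norms_le_norms T N
    refine ⟨max N N', C * C', by positivity, fun R hR ψ => (hb R hR (T ψ)).trans ?_⟩
    calc _ ≤ C * (1 + R) ^ max N N' * (C' * norms ℝ (max N N') ψ) := by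
          gcongr
          · linarith
          · exact le_max_left _ _
          · exact (hb' ψ).trans (by gcongr; exact SchwartzMap.norms_mono (le_max_right _ _) ψ)
      _ = _ := by ring

theorem sub (hZ : TemperedCurveFamily Z) (hW : TemperedCurveFamily W) :
    TemperedCurveFamily (Z - W) where
  continuousOn ψ := (hZ.continuousOn ψ).sub (hW.continuousOn ψ)
  bound ρ hρ := by
    obtain ⟨N, C, hC, hb⟩ := hZ.bound ρ hρ
    obtain ⟨N', C', hC', hb'⟩ := hW.bound ρ hρ
    refine ⟨max N N', C + C', by positivity, fun R hR ψ => ?_⟩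
    have e : translatedMean ρ ((Z - W) ψ) R =
        translatedMean ρ (Z ψ) R - translatedMean ρ (W ψ) R := by
      rw [translatedMean, translatedMean, translatedMean, ← integral_sub
        (hρ.integrable_mul ((hZ.continuousOn ψ).mono Ioi_subset_Ici_self) hR)
        (hρ.integrable_mul ((hW.continuousOn ψ).mono Ioi_subset_Ici_self) hR)]
      simp only [← mul_sub]
      rfl
    rw [e]
    refine (norm_sub_le _ _).trans ?_
    calc _ ≤ C * (1 + R) ^ max N N' * norms ℝ (max N N') ψ +
          C' * (1 + R) ^ max N N' * norms ℝ (max N N') ψ := by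
          gcongr
          · refine (hb R hR ψ).trans ?_
            gcongr
            · linarith
            · exact le_max_left _ _
            · exact SchwartzMap.norms_mono (le_max_left _ _) ψ
          · refine (hb' R hR ψ).trans ?_
            gcongr
            · linarith
            · exact le_max_right _ _
            · exact SchwartzMap.norms_mono (le_max_right _ _) ψ
      _ = _ := by ring

/-- The `x`-derivative is moved onto `ρ`, and the bound is available for every test function. Means
thus give temperedness of `∂ₓ` at no cost. -/
theorem of_hasDerivAt (hZ : TemperedCurveFamily Z) (hc : ∀ ψ, ContinuousOn (W ψ) (Ici 0))
    (hd : ∀ ψ, ∀ x ∈ Ioi (0 : ℝ), HasDerivAt (Z ψ) (W ψ x) x) : TemperedCurveFamily W where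
  continuousOn := hc
  bound ρ hρ := by
    obtain ⟨N, C, hC, hb⟩ := hZ.bound _ hρ.deriv
    refine ⟨N, C, hC, fun R hR ψ => ?_⟩
    rw [hρ.translatedMean_deriv (hd ψ) ((hc ψ).mono Ioi_subset_Ici_self) hR, norm_neg]
    exact hb R hR ψ

end TemperedCurveFamily

/-! ### Uniqueness -/

/-- The pairings of the partial Fourier transform of a curve of distributions. -/
noncomputable def fourierCurve (v : ℝ → 𝓢'(ℝ, ℂ)) : 𝓢(ℝ, ℂ) →ₗ[ℂ] (ℝ → ℂ) where
  toFun ψ x := v x (𝓕 ψ)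
  map_add' ψ χ := by
    ext x
    rw [FourierTransform.fourier_add, map_add]
    rfl
  map_smul' c ψ := by
    ext x
    rw [FourierTransform.fourier_smul, map_smul]
    rfl

theorem fourierCurve_apply (v : ℝ → 𝓢'(ℝ, ℂ)) (ψ : 𝓢(ℝ, ℂ)) (x : ℝ) :
    fourierCurve v ψ x = v x (𝓕 ψ) := rfl

theorem IsTemperedOnHalfPlane.temperedCurveFamily {v : ℝ → 𝓢'(ℝ, ℂ)}
    (hv : IsTemperedOnHalfPlane v) (hc : ∀ φ, ContinuousOn (fun x => v x φ) (Ici 0)) :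
    TemperedCurveFamily (fourierCurve v) where
  continuousOn ψ := hc (𝓕 ψ)
  bound ρ hρ := by
    obtain ⟨V, hV⟩ := hv
    set σ : 𝓢(ℝ, ℂ) := hρ.compact.toSchwartzMap hρ.smooth with hσ
    set T : 𝓢(ℝ, ℂ) →L[ℂ] 𝓢(ℝ × ℝ, ℂ) := SchwartzMap.tensorCLM σ ∘L fourierCLM ℂ 𝓢(ℝ, ℂ) with hT
    have hTa : ∀ ψ z, T ψ z = ρ z.1 * 𝓕 ψ z.2 := fun ψ z => rfl
    obtain ⟨N, C, hC, hb⟩ := SchwartzMap.exists_norm_le_norms V.toFunctional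
    obtain ⟨N', C', hC', hb'⟩ := SchwartzMap.exists_norms_le_norms T N
    refine ⟨max N N', C * 2 ^ N * C', by positivity, fun R hR ψ => ?_⟩
    -- The mean at `R` is the pairing of `V` with a translate of `ρ ⊗ 𝓕 ψ`, and translating by `R`
    -- multiplies Schwartz norms by at most a power of `1 + R`. The compact support of `ρ` makes `Φ`
    -- admissible in the definition of temperedness.
    set Φ := (T ψ).compSubConstCLM ℂ (R, 0) with hΦ
    have hΦa : ∀ x y, Φ (x, y) = ρ (x - R) * 𝓕 ψ y := by
      intro x y
      simp [hΦ, hTa]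
    have hslice : ∀ x, schwartzSlice Φ x = ρ (x - R) • 𝓕 ψ := by
      intro x
      ext y
      rw [schwartzSlice_apply, hΦa, smul_apply, smul_eq_mul]
    obtain ⟨K, hK⟩ := hρ.compact.isCompact.isBounded.subset_closedBall (0 : ℝ)
    have hcomp : ∃ S : ℝ, ∀ x y : ℝ, S ≤ |x| → Φ (x, y) = 0 := by
      refine ⟨|K| + R + 1, fun x y hx => ?_⟩
      rw [hΦa]
      refine mul_eq_zero_of_left (image_eq_zero_of_notMem_tsupport fun hmem => ?_) _
      have h1 := hK hmem
      rw [mem_closedBall_zero_iff, Real.norm_eq_abs] at h1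
      have h2 := abs_sub_abs_le_abs_sub x R
      rw [abs_of_nonneg hR] at h2
      linarith [le_abs_self K]
    have e : translatedMean ρ (fourierCurve v ψ) R = V Φ := by
      rw [hV Φ hcomp, setIntegral_eq_integral_of_forall_compl_eq_zero, translatedMean,
        ← integral_add_right_eq_self (fun x => v x (schwartzSlice Φ x)) R]
      · congr 1
        ext x
        rw [hslice, map_smul, add_sub_cancel_right, smul_eq_mul, fourierCurve_apply]
      · intro x hx
        rw [hslice, hρ.eq_zero_of_nonpos, zero_smul, map_zero]
        rw [mem_Ioi, not_lt] at hx
        linarith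
    rw [e]
    have hnorm : ‖((R, 0) : ℝ × ℝ)‖ = R := by simp [Prod.norm_def, abs_of_nonneg hR, hR]
    have h1 := SchwartzMap.norms_translate_le N ((R, 0) : ℝ × ℝ) (T ψ)
    rw [hnorm] at h1
    refine (hb Φ).trans ?_
    calc _ ≤ C * ((1 + R) ^ max N N' * (2 ^ N * (C' * norms ℝ (max N N') ψ))) := by
          refine mul_le_mul_of_nonneg_left (h1.trans ?_) hC
          gcongr
          · linarith
          · exact le_max_left _ _
          · refine (hb' ψ).trans ?_
            gcongr
            exact SchwartzMap.norms_mono (le_max_right _ _) ψ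
      _ = _ := by ring

/-- The derivatives in `x` of a family of curves. -/
noncomputable def derivCurve (Z : 𝓢(ℝ, ℂ) →ₗ[ℂ] (ℝ → ℂ))
    (hZ : ∀ ψ, ContDiffOn ℝ ∞ (Z ψ) (Ici 0)) : 𝓢(ℝ, ℂ) →ₗ[ℂ] (ℝ → ℂ) where
  -- Clamping `x` at zero lets one differentiability argument give linearity at every `x`; only `x ≥
  -- 0` matters later.
  toFun ψ x := derivWithin (Z ψ) (Ici 0) (max x 0)
  map_add' ψ χ := by
    ext x
    have hd := fun ψ => (hZ ψ).differentiableOn (by simp) (max x 0) (le_max_right x 0)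
    rw [map_add]
    exact derivWithin_add (hd ψ) (hd χ)
  map_smul' c ψ := by
    ext x
    have hd := fun ψ => (hZ ψ).differentiableOn (by simp) (max x 0) (le_max_right x 0)
    rw [map_smul]
    exact derivWithin_const_smul c (hd ψ)

section derivCurve

variable {Z : 𝓢(ℝ, ℂ) →ₗ[ℂ] (ℝ → ℂ)} (hZ : ∀ ψ, ContDiffOn ℝ ∞ (Z ψ) (Ici 0))

theorem derivCurve_apply (ψ : 𝓢(ℝ, ℂ)) {x : ℝ} (hx : x ∈ Ici (0 : ℝ)) :
    derivCurve Z hZ ψ x = derivWithin (Z ψ) (Ici 0) x := by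
  change derivWithin (Z ψ) (Ici 0) (max x 0) = _
  rw [max_eq_left hx]

theorem contDiffOn_derivCurve (ψ : 𝓢(ℝ, ℂ)) : ContDiffOn ℝ ∞ (derivCurve Z hZ ψ) (Ici 0) :=
  ((contDiffOn_infty_iff_derivWithin (uniqueDiffOn_Ici 0)).1 (hZ ψ)).2.congr
    fun _ hx => derivCurve_apply hZ ψ hx

theorem hasDerivAt_derivCurve (ψ : 𝓢(ℝ, ℂ)) {x : ℝ} (hx : x ∈ Ioi (0 : ℝ)) :
    HasDerivAt (Z ψ) (derivCurve Z hZ ψ x) x := by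
  have hx' : x ∈ Ici (0 : ℝ) := Ioi_subset_Ici_self hx
  rw [derivCurve_apply hZ ψ hx']
  exact (((hZ ψ).differentiableOn (by simp) x hx').hasDerivWithinAt).hasDerivAt
    (Ici_mem_nhds hx)

theorem derivCurve_derivCurve (ψ : 𝓢(ℝ, ℂ)) {x : ℝ} (hx : x ∈ Ici (0 : ℝ)) :
    derivCurve (derivCurve Z hZ) (contDiffOn_derivCurve hZ) ψ x =
      iteratedDerivWithin 2 (Z ψ) (Ici 0) x := by
  rw [derivCurve_apply _ ψ hx, iteratedDerivWithin_succ, iteratedDerivWithin_one]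
  exact derivWithin_congr (fun t ht => derivCurve_apply hZ ψ ht) (derivCurve_apply hZ ψ hx)

end derivCurve

namespace TiltedParaxial.IsAdmissible

variable {kx ky ε ν : ℝ} (h : IsAdmissible kx ky ε ν)
include h

theorem eqOn_solution {g : 𝓢'(ℝ, ℂ)} {v : ℝ → 𝓢'(ℝ, ℂ)} (hv : IsHalfPlaneSolution kx ky ε ν g v) :
    EqOn v (solution kx ky ε ν g) (Ici 0) := by
  have hp := hasTemperateGrowth_derivSymbol
  have hl := h.hasTemperateGrowth_lamM
  have hm := h.hasTemperateGrowth_lamP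
  have ht := h.hasTemperateGrowth_traceSymbol
  set P := SchwartzMap.smulLeftCLM ℂ derivSymbol with hP
  set A := SchwartzMap.smulLeftCLM ℂ (lamM kx ky ε ν) with hA
  set B := SchwartzMap.smulLeftCLM ℂ (lamP kx ky ε ν) with hB
  set Z := fourierCurve v with hZdef
  have hZs : ∀ ψ, ContDiffOn ℝ ∞ (Z ψ) (Ici 0) := fun ψ => hv.smooth (𝓕 ψ)
  have hZ : TemperedCurveFamily Z :=
    hv.tempered.temperedCurveFamily fun φ => (hv.smooth φ).continuousOn
  set D := derivCurve Z hZs with hDdef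
  have hDs := contDiffOn_derivCurve hZs
  have hD : TemperedCurveFamily D :=
    hZ.of_hasDerivAt (fun ψ => (hDs ψ).continuousOn) fun ψ x hx => hasDerivAt_derivCurve hZs ψ hx
  -- This family is `(∂ₓ - lamM)û`, the inner factor of the equation.
  have hW : TemperedCurveFamily (D - Z ∘ₗ A.toLinearMap) := hD.sub (hZ.comp A)
  have hc : (ε / 2 : ℂ) * (ky : ℂ) ^ 2 ≠ 0 := by
    have := h.eps_pos.ne'
    have := h.ky_ne
    simp [*]
  have hfactor : ∀ ψ, ∀ x ∈ Ioi (0 : ℝ), HasDerivAt ((D - Z ∘ₗ A.toLinearMap) ψ)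
      ((D - Z ∘ₗ A.toLinearMap) (B ψ) x) x := by
    intro ψ x hx
    have hx' : x ∈ Ici (0 : ℝ) := Ioi_subset_Ici_self hx
    refine ((hasDerivAt_derivCurve hDs ψ hx).sub
      (hasDerivAt_derivCurve hZs (A ψ) hx)).congr_deriv ?_
    rw [derivCurve_derivCurve hZs ψ hx']
    change _ - D (A ψ) x = D (B ψ) x - Z (A (B ψ)) x
    have heq := hv.equation x hx (𝓕 ψ)
    have e1 : derivWithin (fun t => derivCLM ℂ (v t) (𝓕 ψ)) (Ici 0) x = D (P ψ) x := by
      rw [hDdef, derivCurve_apply hZs _ hx']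
      simp only [derivCLM_fourier_apply]
      rfl
    rw [e1, show derivWithin (fun t => v t (𝓕 ψ)) (Ici 0) x = D ψ x from
      (derivCurve_apply hZs ψ hx').symm] at heq
    simp only [derivCLM_fourier_apply] at heq
    change Complex.I * (kx * D ψ x + ky * Z (P ψ) x) + (ε / 2 : ℂ) * ((kx : ℂ) ^ 2 * Z (P (P ψ)) x
      - 2 * kx * ky * D (P ψ) x + (ky : ℂ) ^ 2 * iteratedDerivWithin 2 (Z ψ) (Ici 0) x) +
      Complex.I * ν * Z ψ x = 0 at heq
    -- Vieta's formulas as identities between operators on test functions; they turn the second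
    -- order equation into the growing first order one.
    have s1 : ((ε / 2 : ℂ) * (ky : ℂ) ^ 2) • (A ψ + B ψ) =
        (-(Complex.I * kx)) • ψ + (ε * kx * ky : ℂ) • P ψ := by
      ext ξ
      simp only [hA, hB, hP, add_apply, smul_apply, SchwartzMap.smulLeftCLM_apply_apply hp,
        SchwartzMap.smulLeftCLM_apply_apply hl, SchwartzMap.smulLeftCLM_apply_apply hm, smul_eq_mul]
      linear_combination ψ ξ * h.lamM_add_lamP ξ
    have s2 : ((ε / 2 : ℂ) * (ky : ℂ) ^ 2) • A (B ψ) =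
        (Complex.I * ky) • P ψ + (ε / 2 * kx ^ 2 : ℂ) • P (P ψ) + (Complex.I * ν) • ψ := by
      ext ξ
      simp only [hA, hB, hP, add_apply, smul_apply, SchwartzMap.smulLeftCLM_apply_apply hp,
        SchwartzMap.smulLeftCLM_apply_apply hl, SchwartzMap.smulLeftCLM_apply_apply hm, smul_eq_mul]
      linear_combination ψ ξ * h.lamM_mul_lamP ξ
    have t1 := congrFun (congrArg D s1) x
    have t2 := congrFun (congrArg Z s2) x
    simp only [map_add, map_smul, Pi.add_apply, Pi.smul_apply, smul_eq_mul] at t1 t2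
    refine mul_left_cancel₀ hc ?_
    linear_combination heq - t1 + t2
  have hW0 := hW.eq_zero_of_growing h.isDecayExponent_neg_lamP hfactor
  have hDA : ∀ ψ, ∀ x ∈ Ici (0 : ℝ), D ψ x = Z (A ψ) x := fun ψ x hx =>
    sub_eq_zero.1 (hW0 ψ x hx)
  have hZd : ∀ ψ, ∀ x ∈ Ici (0 : ℝ), Z ψ x =
      Z (SchwartzMap.smulLeftCLM ℂ (expMul (lamM kx ky ε ν) x.toNNReal) ψ) 0 :=
    hZ.eq_of_decaying h.isDecayExponent_lamM fun ψ x hx => by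
      rw [← hDA ψ x (Ioi_subset_Ici_self hx)]
      exact hasDerivAt_derivCurve hZs ψ hx
  have hZ0 : ∀ χ, Z χ 0 = traceFunctional kx ky ε ν g χ := by
    intro χ
    -- Testing the boundary condition on the trace symbol times `χ` inverts the boundary symbol and
    -- isolates `Z χ 0`.
    set ψ := SchwartzMap.smulLeftCLM ℂ (traceSymbol kx ky ε ν) χ with hψ
    have hb := hv.boundary (𝓕 ψ)
    have e1 : derivWithin (fun t => v t (𝓕 ψ)) (Ici 0) 0 = Z (A ψ) 0 := by
      rw [← hDA ψ 0 self_mem_Ici]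
      exact (derivCurve_apply hZs ψ self_mem_Ici).symm
    rw [e1, derivCLM_fourier_apply] at hb
    change Complex.I * ε * ky * (kx * Z (P ψ) 0 - ky * Z (A ψ) 0) + 2 * kx * Z ψ 0 =
      2 * kx * traceFunctional kx ky ε ν g χ at hb
    have s : (Complex.I * ε * ky) • ((kx : ℂ) • P ψ - (ky : ℂ) • A ψ) + (2 * kx : ℂ) • ψ =
        (2 * kx : ℂ) • χ := by
      ext ξ
      simp only [hA, hP, hψ, add_apply, sub_apply, smul_apply,
        SchwartzMap.smulLeftCLM_apply_apply hp, SchwartzMap.smulLeftCLM_apply_apply hl,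
        SchwartzMap.smulLeftCLM_apply_apply ht, smul_eq_mul]
      have h1 := h.boundarySymbol_mul_traceSymbol ξ
      rw [h.boundarySymbol_eq] at h1
      linear_combination χ ξ * h1
    have t := congrFun (congrArg Z s) 0
    simp only [map_add, map_sub, map_smul, Pi.add_apply, Pi.sub_apply, Pi.smul_apply,
      smul_eq_mul] at t
    have hkx : (2 * kx : ℂ) ≠ 0 := by
      have := h.kx_pos.ne'
      simp [this]
    refine mul_left_cancel₀ hkx ?_
    rw [← t, ← hb]
  intro x hx
  ext φ
  obtain ⟨ψ, rfl⟩ : ∃ ψ : 𝓢(ℝ, ℂ), φ = 𝓕 ψ := ⟨𝓕⁻ φ, (fourier_fourierInv_eq φ).symm⟩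
  rw [h.solution_fourier, ← hZ0, ← hZd ψ x hx]
  rfl

theorem isUniqueHalfPlaneSolution_solution (g : 𝓢'(ℝ, ℂ)) :
    IsUniqueHalfPlaneSolution kx ky ε ν g (solution kx ky ε ν g) :=
  ⟨h.isHalfPlaneSolution_solution g, fun _ hv => h.eqOn_solution hv⟩

end TiltedParaxial.IsAdmissible

/-! ### Bounded multipliers on `L²` -/

/-- The Fourier multiplier with a bounded symbol, as an operator on `L²`. -/
noncomputable def boundedMultiplier {m : ℝ → ℂ} (hm : MemLp m ∞ volume)
    (F : Lp ℂ 2 (volume : Measure ℝ)) : Lp ℂ 2 (volume : Measure ℝ) :=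
  𝓕⁻ (hm.toLp m • 𝓕 F : Lp ℂ 2 (volume : Measure ℝ))

theorem toTemperedDistribution_boundedMultiplier {m : ℝ → ℂ} (hm : MemLp m ∞ volume)
    (hmt : m.HasTemperateGrowth) (F : Lp ℂ 2 (volume : Measure ℝ)) :
    (boundedMultiplier hm F : 𝓢'(ℝ, ℂ)) = fourierMultiplierCLM ℂ m (F : 𝓢'(ℝ, ℂ)) := by
  rw [boundedMultiplier, ← Lp.fourierInv_toTemperedDistribution_eq,
    Lp.toTemperedDistribution_smul_eq hmt, ← Lp.fourier_toTemperedDistribution_eq,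
    fourierMultiplierCLM_apply]

theorem norm_fourierInv_L2 (F : Lp ℂ 2 (volume : Measure ℝ)) : ‖𝓕⁻ F‖ = ‖F‖ := by
  rw [← Lp.norm_fourier_eq, fourier_fourierInv_eq]

theorem ae_smul_toLp_fourier {m : ℝ → ℂ} (hm : MemLp m ∞ volume)
    (G : Lp ℂ 2 (volume : Measure ℝ)) :
    ∀ᵐ ξ, (hm.toLp m • G : Lp ℂ 2 (volume : Measure ℝ)) ξ = m ξ * G ξ := by
  filter_upwards [Lp.coeFn_lpSMul (r := 2) (hm.toLp m) G, hm.coeFn_toLp] with ξ h1 h2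
  rw [h1, Pi.smul_apply', h2, smul_eq_mul]

theorem norm_boundedMultiplier_le {m : ℝ → ℂ} (hm : MemLp m ∞ volume) {K : ℝ}
    (hK : ∀ ξ, ‖m ξ‖ ≤ K) (F : Lp ℂ 2 (volume : Measure ℝ)) :
    ‖boundedMultiplier hm F‖ ≤ K * ‖F‖ := by
  rw [boundedMultiplier, norm_fourierInv_L2, ← Lp.norm_fourier_eq F]
  refine Lp.norm_le_mul_norm_of_ae_le_mul ?_
  filter_upwards [ae_smul_toLp_fourier hm (𝓕 F)] with ξ h1
  rw [h1, norm_mul]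
  gcongr
  exact hK ξ

/-- Dominated convergence on the Fourier side: symbols bounded by `K` and converging pointwise give
strong convergence, with majorant `|2K · 𝓕 F|²`. Uniform convergence of the symbols is not needed.
-/
theorem tendsto_boundedMultiplier {α : Type*} {l : Filter α} [l.IsCountablyGenerated]
    {m : α → ℝ → ℂ} {m₀ : ℝ → ℂ} (hm : ∀ x, MemLp (m x) ∞ volume) (hm₀ : MemLp m₀ ∞ volume) {K : ℝ}
    (hK : ∀ x ξ, ‖m x ξ‖ ≤ K) (hK₀ : ∀ ξ, ‖m₀ ξ‖ ≤ K)
    (hlim : ∀ ξ, Tendsto (fun x => m x ξ) l (𝓝 (m₀ ξ))) (F : Lp ℂ 2 (volume : Measure ℝ)) :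
    Tendsto (fun x => boundedMultiplier (hm x) F) l (𝓝 (boundedMultiplier hm₀ F)) := by
  set G := 𝓕 F with hG
  refine ((Lp.fourierTransformₗᵢ ℝ ℂ).symm.continuous.tendsto _).comp ?_
  rw [Lp.tendsto_Lp_iff_tendsto_eLpNorm']
  have hE : ∀ x, eLpNorm (⇑((hm x).toLp (m x) • G : Lp ℂ 2 (volume : Measure ℝ)) -
      ⇑(hm₀.toLp m₀ • G : Lp ℂ 2 (volume : Measure ℝ))) 2 volume =
      (∫⁻ ξ, ‖(m x ξ - m₀ ξ) * G ξ‖ₑ ^ (2 : ℝ)) ^ (1 / 2 : ℝ) := by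
    intro x
    rw [eLpNorm_eq_lintegral_rpow_enorm_toReal (by simp) (by simp)]
    simp only [ENNReal.toReal_ofNat]
    congr 1
    refine lintegral_congr_ae ?_
    filter_upwards [ae_smul_toLp_fourier (hm x) G, ae_smul_toLp_fourier hm₀ G] with ξ h1 h2
    rw [Pi.sub_apply, h1, h2, sub_mul]
  refine Tendsto.congr (fun x => (hE x).symm) ?_
  have h0 : Tendsto (fun x => ∫⁻ ξ, ‖(m x ξ - m₀ ξ) * G ξ‖ₑ ^ (2 : ℝ)) l (𝓝 (∫⁻ _ : ℝ, 0)) := by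
    refine tendsto_lintegral_filter_of_dominated_convergence'
      (fun ξ => ‖((2 * K : ℝ) : ℂ) * G ξ‖ₑ ^ (2 : ℝ)) (Eventually.of_forall fun x => ?_)
      (Eventually.of_forall fun x => Eventually.of_forall fun ξ => ?_) ?_
      (Eventually.of_forall fun ξ => ?_)
    · exact ((((hm x).aestronglyMeasurable.sub hm₀.aestronglyMeasurable).mul
        (Lp.aestronglyMeasurable G)).enorm).pow_const _
    · refine ENNReal.rpow_le_rpow ?_ (by simp)
      rw [enorm_mul, enorm_mul]
      gcongr
      rw [enorm_le_iff_norm_le, Complex.norm_real, Real.norm_eq_abs]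
      refine (norm_sub_le _ _).trans (le_trans ?_ (le_abs_self _))
      linarith [hK x ξ, hK₀ ξ]
    · have h2 := ((Lp.memLp G).const_mul ((2 * K : ℝ) : ℂ))
      have h3 := lintegral_rpow_enorm_lt_top_of_eLpNorm_lt_top (by simp) (by simp) h2.2
      simpa using h3.ne
    · have h1 : Tendsto (fun x => (m x ξ - m₀ ξ) * G ξ) l (𝓝 0) := by
        simpa using ((hlim ξ).sub_const (m₀ ξ)).mul_const (G ξ)
      have h2 := (continuous_enorm.tendsto (0 : ℂ)).comp h1
      rw [enorm_zero] at h2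
      have h3 := ((ENNReal.continuous_rpow_const (y := 2)).tendsto 0).comp h2
      rwa [ENNReal.zero_rpow_of_pos (by norm_num)] at h3
  rw [lintegral_zero] at h0
  have h1 := ((ENNReal.continuous_rpow_const (y := (1 / 2 : ℝ))).tendsto 0).comp h0
  rwa [ENNReal.zero_rpow_of_pos (by norm_num)] at h1

/-- The infimum runs over a single element, since `L²` embeds injectively in tempered distributions.
-/
theorem sobolevNorm_eq {s : ℝ} {f : 𝓢'(ℝ, ℂ)} {F : Lp ℂ 2 (volume : Measure ℝ)}
    (h : besselPotential ℝ ℂ s f = (F : 𝓢'(ℝ, ℂ))) : sobolevNorm s f = ‖F‖ₑ := by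
  refine le_antisymm (iInf₂_le F h) (le_iInf₂ fun F' h' => ?_)
  have hinj : Function.Injective
      (Lp.toTemperedDistributionCLM ℂ (volume : Measure ℝ) (2 : ℝ≥0∞)) :=
    LinearMap.ker_eq_bot.1 Lp.ker_toTemperedDistributionCLM_eq_bot
  rw [hinj (h.symm.trans h')]

/-! ### Sobolev bounds for the solution -/

namespace TiltedParaxial

/-- The symbol of the operator from `H^s` to `H^(s + 1/2)` which maps the entrance datum to the
value of the solution at `x`. -/
noncomputable def sobolevSymbol (kx ky ε ν : ℝ) (x : ℝ≥0) (ξ : ℝ) : ℂ :=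
  ((1 + ‖ξ‖ ^ 2) ^ (1 / 4 : ℝ) : ℝ) * (expMul (lamM kx ky ε ν) x ξ * traceSymbol kx ky ε ν ξ)

/-- The norm of the solution operator from `H^s` to `H^(s + 1/2)`. -/
noncomputable def sobolevConstant (kx ky ε : ℝ) : ℝ :=
  2 * kx * ((kx ^ 4)⁻¹ + ((2 * Real.pi * ε * ky) ^ 2)⁻¹) ^ (1 / 4 : ℝ)

namespace IsAdmissible

variable {kx ky ε ν : ℝ} (h : IsAdmissible kx ky ε ν)
include h

theorem hasTemperateGrowth_sobolevSymbol (x : ℝ≥0) :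
    (sobolevSymbol kx ky ε ν x).HasTemperateGrowth := by
  have h1 := h.isDecayExponent_lamM.temperate_expMul x
  have h2 := h.hasTemperateGrowth_traceSymbol
  unfold sobolevSymbol
  fun_prop

theorem norm_sobolevSymbol_le (x : ℝ≥0) (ξ : ℝ) :
    ‖sobolevSymbol kx ky ε ν x ξ‖ ≤ sobolevConstant kx ky ε := by
  refine le_trans ?_ (h.norm_traceSymbol_le ξ)
  have h1 : ‖expMul (lamM kx ky ε ν) x ξ‖ ≤ 1 := by
    rw [norm_expMul, Real.exp_le_one_iff]
    exact mul_nonpos_of_nonneg_of_nonpos x.coe_nonneg (h.isDecayExponent_lamM.neg ξ).le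
  rw [sobolevSymbol, norm_mul, norm_mul, Complex.norm_real, Real.norm_of_nonneg (by positivity),
    Real.norm_eq_abs, sq_abs, mul_comm]
  gcongr
  exact mul_le_of_le_one_left (norm_nonneg _) h1

theorem memLp_sobolevSymbol (x : ℝ≥0) : MemLp (sobolevSymbol kx ky ε ν x) ∞ volume :=
  memLp_top_of_bound (h.hasTemperateGrowth_sobolevSymbol x).1.continuous.aestronglyMeasurable _
    (Eventually.of_forall (h.norm_sobolevSymbol_le x))

/-- The Bessel potential of the solution, as a curve in `L²`. -/
noncomputable def potentialCurve (h : IsAdmissible kx ky ε ν)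
    (F : Lp ℂ 2 (volume : Measure ℝ)) (x : ℝ) : Lp ℂ 2 (volume : Measure ℝ) :=
  boundedMultiplier (h.memLp_sobolevSymbol x.toNNReal) F

/-- The weights satisfy `(s + 1/2)/2 = s/2 + 1/4`, so after factoring out the potential of `g` a
symbol independent of `s` remains. One `L²` bound therefore serves all Sobolev exponents. -/
theorem besselPotential_solution {s : ℝ} {g : 𝓢'(ℝ, ℂ)} {F : Lp ℂ 2 (volume : Measure ℝ)}
    (hF : besselPotential ℝ ℂ s g = (F : 𝓢'(ℝ, ℂ))) (x : ℝ) :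
    besselPotential ℝ ℂ (s + 1 / 2) (solution kx ky ε ν g x) =
      (h.potentialCurve F x : 𝓢'(ℝ, ℂ)) := by
  have h1 := h.isDecayExponent_lamM.temperate_expMul x.toNNReal
  have h2 := h.hasTemperateGrowth_traceSymbol
  rw [potentialCurve, toTemperedDistribution_boundedMultiplier _
    (h.hasTemperateGrowth_sobolevSymbol _), ← hF, besselPotential, besselPotential, solution,
    fourierMultiplierCLM_fourierMultiplierCLM_apply (by fun_prop) (by fun_prop),
    fourierMultiplierCLM_fourierMultiplierCLM_apply (by fun_prop)
      (h.hasTemperateGrowth_sobolevSymbol _)]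
  congr 2
  ext ξ
  simp only [Pi.mul_apply, sobolevSymbol]
  rw [show (s + 1 / 2) / 2 = s / 2 + 1 / 4 by ring, Real.rpow_add (by positivity)]
  push_cast
  ring

theorem norm_potentialCurve_le (F : Lp ℂ 2 (volume : Measure ℝ)) (x : ℝ) :
    ‖h.potentialCurve F x‖ ≤ sobolevConstant kx ky ε * ‖F‖ :=
  norm_boundedMultiplier_le _ (h.norm_sobolevSymbol_le _) F

theorem continuous_potentialCurve (F : Lp ℂ 2 (volume : Measure ℝ)) :
    Continuous (h.potentialCurve F) := by
  refine continuous_iff_continuousAt.2 fun x => ?_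
  refine tendsto_boundedMultiplier (m := fun t : ℝ => sobolevSymbol kx ky ε ν t.toNNReal)
    (m₀ := sobolevSymbol kx ky ε ν x.toNNReal) (K := sobolevConstant kx ky ε)
    (fun t => h.memLp_sobolevSymbol t.toNNReal)
    (h.memLp_sobolevSymbol x.toNNReal) (fun t => h.norm_sobolevSymbol_le t.toNNReal)
    (h.norm_sobolevSymbol_le _) (fun ξ => ?_) F
  have h1 : Continuous fun t : ℝ => (((t.toNNReal : ℝ≥0) : ℝ) : ℂ) :=
    Complex.continuous_ofReal.comp (NNReal.continuous_coe.comp continuous_real_toNNReal)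
  exact (continuous_const.mul
    ((Complex.continuous_exp.comp (h1.mul continuous_const)).mul continuous_const)).tendsto x

theorem sobolevConstant_nonneg : 0 ≤ sobolevConstant kx ky ε :=
  (norm_nonneg _).trans (h.norm_sobolevSymbol_le 0 0)

theorem enorm_potentialCurve_le (F : Lp ℂ 2 (volume : Measure ℝ)) (x : ℝ) :
    ‖h.potentialCurve F x‖ₑ ≤ (sobolevConstant kx ky ε).toNNReal * ‖F‖ₑ := by
  have h1 := h.norm_potentialCurve_le F x
  rw [← ofReal_norm, ← ofReal_norm, ← ENNReal.ofReal,
    ← ENNReal.ofReal_mul h.sobolevConstant_nonneg]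
  exact ENNReal.ofReal_le_ofReal h1

theorem exists_continuousMap_solution {g : 𝓢'(ℝ, ℂ)} (hg : MemSobolev (-1 / 2 : ℝ) 2 g) :
    ∃ U : Ici (0 : ℝ) →ᵇ Lp ℂ 2 (volume : Measure ℝ),
      (∀ x : Ici (0 : ℝ), solution kx ky ε ν g x = (U x : 𝓢'(ℝ, ℂ))) ∧
      ‖U‖ₑ ≤ (sobolevConstant kx ky ε).toNNReal * sobolevNorm (-1 / 2 : ℝ) g := by
  obtain ⟨F, hF⟩ := hg
  refine ⟨BoundedContinuousFunction.ofNormedAddCommGroup (fun x : Ici (0 : ℝ) =>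
    h.potentialCurve F x) ((h.continuous_potentialCurve F).comp continuous_subtype_val)
    (sobolevConstant kx ky ε * ‖F‖) fun x => h.norm_potentialCurve_le F x, fun x => ?_, ?_⟩
  · have := h.besselPotential_solution hF x
    rw [show (-1 / 2 + 1 / 2 : ℝ) = 0 by norm_num, besselPotential_zero] at this
    exact this
  · rw [sobolevNorm_eq hF, ← ofReal_norm, ← ofReal_norm, ← ENNReal.ofReal,
      ← ENNReal.ofReal_mul h.sobolevConstant_nonneg]
    refine ENNReal.ofReal_le_ofReal ?_
    have := mul_nonneg h.sobolevConstant_nonneg (norm_nonneg F)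
    exact (BoundedContinuousFunction.norm_le this).2 fun x => h.norm_potentialCurve_le F x

theorem supSobolevNorm_solution_le {s : ℝ} {g : 𝓢'(ℝ, ℂ)} (hg : MemSobolev s 2 g) :
    supSobolevNorm (s + 1 / 2) (solution kx ky ε ν g) ≤
      (sobolevConstant kx ky ε).toNNReal * sobolevNorm s g := by
  obtain ⟨F, hF⟩ := hg
  refine iSup₂_le fun x _ => ?_
  rw [sobolevNorm_eq hF, sobolevNorm_eq (h.besselPotential_solution hF x)]
  exact h.enorm_potentialCurve_le F x

theorem isBoundedContinuousSobolev_solution {s : ℝ} {g : 𝓢'(ℝ, ℂ)} (hg : MemSobolev s 2 g) :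
    IsBoundedContinuousSobolev (s + 1 / 2) (solution kx ky ε ν g) where
  mem x _ := by
    obtain ⟨F, hF⟩ := hg
    exact ⟨_, h.besselPotential_solution hF x⟩
  continuous x _ := by
    obtain ⟨F, hF⟩ := hg
    have e : ∀ t, sobolevNorm (s + 1 / 2) (solution kx ky ε ν g t - solution kx ky ε ν g x) =
        ‖h.potentialCurve F t - h.potentialCurve F x‖ₑ := fun t => by
      refine sobolevNorm_eq ?_
      rw [map_sub, h.besselPotential_solution hF, h.besselPotential_solution hF,
        ← Lp.toTemperedDistributionCLM_apply, ← Lp.toTemperedDistributionCLM_apply,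
        ← Lp.toTemperedDistributionCLM_apply, map_sub]
    simp only [e]
    have hc : Continuous fun t => ‖h.potentialCurve F t - h.potentialCurve F x‖ₑ :=
      ((h.continuous_potentialCurve F).sub continuous_const).enorm
    have := hc.tendsto x
    rw [sub_self, enorm_zero] at this
    exact this.mono_left nhdsWithin_le_nhds
  bounded := by
    refine (h.supSobolevNorm_solution_le hg).trans_lt ?_
    obtain ⟨F, hF⟩ := hg
    rw [sobolevNorm_eq hF]
    exact ENNReal.mul_lt_top ENNReal.coe_lt_top enorm_lt_top

end IsAdmissible

end TiltedParaxial

end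

theorem corollary1 (kx ky ε : ℝ) (hk : kx ^ 2 + ky ^ 2 = 1) (hkx : 0 < kx) (hky : ky ≠ 0)
    (hε : 0 < ε) :
    ∃ C : ℝ≥0, ∀ ν : ℝ, 0 < ν →
      (∀ g : 𝓢'(ℝ, ℂ), MemSobolev (-1 / 2 : ℝ) 2 g →
        ∃ u : ℝ → 𝓢'(ℝ, ℂ), IsUniqueHalfPlaneSolution kx ky ε ν g u ∧
          ∃ U : Ici (0 : ℝ) →ᵇ Lp ℂ 2 (volume : Measure ℝ),
            (∀ x : Ici (0 : ℝ), u x = (U x : 𝓢'(ℝ, ℂ))) ∧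
            ‖U‖ₑ ≤ C * sobolevNorm (-1 / 2 : ℝ) g) ∧
      (∀ (s : ℝ) (g : 𝓢'(ℝ, ℂ)), MemSobolev s 2 g →
        ∃ u : ℝ → 𝓢'(ℝ, ℂ), IsUniqueHalfPlaneSolution kx ky ε ν g u ∧
          IsBoundedContinuousSobolev (s + 1 / 2) u ∧
          supSobolevNorm (s + 1 / 2) u ≤ C * sobolevNorm s g) := by
  -- This constant is chosen before `ν` and is the same for every `s`.
  refine ⟨(TiltedParaxial.sobolevConstant kx ky ε).toNNReal, fun ν hν => ?_⟩
  have h : TiltedParaxial.IsAdmissible kx ky ε ν := ⟨hk, hkx, hky, hε, hν⟩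
  exact ⟨fun g hg => ⟨_, h.isUniqueHalfPlaneSolution_solution g,
      h.exists_continuousMap_solution hg⟩,
    fun s g hg => ⟨_, h.isUniqueHalfPlaneSolution_solution g,
      h.isBoundedContinuousSobolev_solution hg, h.supSobolevNorm_solution_le hg⟩⟩
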